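/- **Corollary 1.2.** Let $M$ be a (not necessarily simple) matroid on $[n]=\{1,\dots,n\}$ of rank $r\ge 2$. Let $\mathcal B(M)$ be the set of bases of $M$, $\mathcal B_i(M)=\{B\in\mathcal B(M)\mid i\in B\}$ and $\mathcal B_{ij}(M)=\{B\in\mathcal B(M)\mid \{i,j\}\subset B\}$. Let $I_k(M)$ be the number of independent sets of $M$ of size $k$, and for $0\le k\le n$ let $\widetilde I_k(M)=I_k(M)/\binom nk$. Two distinct elements are parallel if they form a circuit of size $2$; the parallel classes of $M$ are the classes of the equivalence relation "equal or parallel" on the set of non-loops. The girth of $M$, $\mathrm{girth}(M)$, is the minimum cardinality of a circuit of $M$ ($\infty$ if $M$ has no circuit). (i) Let $i\neq j$ in $[n]$ be non-loops. Then $$|\mathcal B(M)|\cdot|\mathcal B_{ij}(M)| = 2\Bigl(1-\frac1r\Bigr)|\mathcal B_i(M)|\cdot|\mathcal B_j(M)|$$ if and only if $i$ and $j$ are not parallel and $M$ has exactly two parallel classes. (ii) Let $k$ be an integer with $1\le k\le r$ and $k<n$. Then $$\widetilde I_{k-1}(M)\,\widetilde I_{k+1}(M)=\bigl(\widetilde I_k(M)\bigr)^2$$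 if and only if $k+1<\mathrm{girth}(M)$. -/

import Mathlib

namespace Matroid

/-- `e` and `f` are parallel: both are non-loops, and either they coincide or they form a
2-element circuit. (Every non-loop counts as parallel to itself, as is required for the parallel
classes to partition the set of non-loops.) -/
def AreParallel {α : Type*} (M : Matroid α) (e f : α) : Prop :=
  (e = f ∧ M.IsNonloop e) ∨ (e ≠ f ∧ M.IsCircuit {e, f})

/-- The set of parallel classes of `M`: the blocks of the partition of the set of non-loops into
classes of mutually parallel elements. The set of loops is not a parallel class. -/
def parallelClasses {α : Type*} (M : Matroid α) : Set (Set α) :=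
  {C | ∃ e, M.IsNonloop e ∧ C = {f | M.AreParallel e f}}

/-- The girth of `M`: the minimum cardinality of a circuit of `M`, with the value `⊤` if `M` has no
circuit. -/
noncomputable def girth {α : Type*} (M : Matroid α) : ℕ∞ :=
  sInf {c | ∃ C, M.IsCircuit C ∧ c = C.encard}

/-- The number of bases of `M` that contain the set `S`. -/
noncomputable def numBasesContaining {α : Type*} (M : Matroid α) (S : Set α) : ℕ :=
  {B : Set α | M.IsBase B ∧ S ⊆ B}.ncard

/-- The number `I_k(M)` of independent sets of `M` of size `k`. -/
noncomputable def numIndep {α : Type*} (M : Matroid α) (k : ℕ) : ℕ :=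
  {I : Set α | M.Indep I ∧ I.encard = k}.ncard

/-- The normalized number `I_k(M) / (n choose k)` of independent sets of size `k` of a matroid `M`
on `n` elements. -/
noncomputable def normIndep {n : ℕ} (M : Matroid (Fin n)) (k : ℕ) : ℝ :=
  (M.numIndep k : ℝ) / (n.choose k : ℝ)

end Matroid

/-! Write n for the number of elements. Both equalities are equality cases of a reversed
Cauchy–Schwarz inequality for a Lorentzian polynomial, the sum of w₀^(n-|I|) w^I over the
independent sets I. Differentiating it by the variables in J and n-d-2 times by w₀ leaves a form
whose Hessian, at w₀ = 0 and the other variables 1, is a multiple of `indepHessian M d J`. Its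
entries count independent sets of sizes d, d+1, d+2 that contain J. When d+2 is at most the rank and
J is independent with |J| ≤ d, this matrix is negative semidefinite on the hyperplane orthogonal,
for the form itself, to the direction of w₀ (`hasLorentzianHessian`).

The proof is by induction on d - |J|. For |J| = d the Hessian is explicit in terms of the parallel
classes of M ／ J, and Cauchy–Schwarz suffices. For |J| < d, Euler's identities express H_J through
the matrices H_{J∪i} (`sum_indepHessian_insert`, `indepHessian_insert_mulVec`). Reversed
Cauchy–Schwarz for each of these gives the Bochner-type inequality `dotProduct_indepHessian_le`. It
confines the eigenvalues of the normalized Schur complement of H_J to λ ≤ 0 or λ ≥ 1. The second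
range is excluded by a Dirichlet form on a connected graph
(`Matrix.dotProduct_mulVec_nonpos_of_bochner`).

In an equality case some explicit z is isotropic and orthogonal to a positive vector, hence lies in
the kernel of H_∅. The kernel propagates: H_∅ z = 0 forces H_J z = 0 for every independent J with
|J| ≤ d (`indepHessian_mulVec_eq_zero_of_empty`). At |J| = d the explicit matrix can be read off. In
(ii), with d = k-1, M ／ J has neither loops nor parallel pairs, whence the girth bound. In (i), with
d = r-2, a nonloop parallel to neither i nor j gives, for a suitable J, a parallel class on which z
is constant and negative although its sum over that class must vanish. -/

open Finset Matrix

/-! ### Linear algebra of forms with one positive direction. -/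

/-- Reversed Cauchy–Schwarz for a form that is negative semidefinite on a hyperplane `u^⊥`. -/
theorem LinearMap.BilinForm.mul_le_sq_of_nonpos_on_orthogonal {V : Type*} [AddCommGroup V]
    [Module ℝ V] {Q : LinearMap.BilinForm ℝ V} (hQ : Q.IsSymm) {u : V}
    (hu : ∀ z, Q z u = 0 → Q z z ≤ 0) {w : V} (hw : 0 ≤ Q w w) (v : V) :
    Q v v * Q w w ≤ Q v w ^ 2 := by
  rcases hw.eq_or_lt with h0 | hpos
  · rw [← h0, mul_zero]; positivity
  have hne : Q w u ≠ 0 := fun h => (hu w h).not_gt hpos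
  -- This combination of v and w is orthogonal to u. Multiplying its nonpositive norm by `Q w w` and
  -- completing the square gives the claim.
  have hz := hu (Q w u • v - Q v u • w) (by simp; ring)
  have hs : Q w v = Q v w := hQ.eq w v
  simp only [map_sub, map_smul, LinearMap.sub_apply, LinearMap.smul_apply, smul_eq_mul, hs] at hz
  have hp : 0 < Q w u ^ 2 := by positivity
  by_contra! hlt
  nlinarith [mul_pos hp (sub_pos.2 hlt), sq_nonneg (Q w w * Q v u - Q v w * Q w u),
    mul_nonpos_of_nonneg_of_nonpos hpos.le hz]

/-- An isotropic vector orthogonal to a positive vector `w` lies in the kernel of a form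
satisfying the reversed Cauchy–Schwarz inequality with respect to `w`. -/
theorem LinearMap.BilinForm.eq_zero_of_isotropic_of_mul_le_sq {V : Type*} [AddCommGroup V]
    [Module ℝ V] {Q : LinearMap.BilinForm ℝ V} (hQ : Q.IsSymm) {w z : V}
    (hw : 0 < Q w w) (hrev : ∀ v, Q v v * Q w w ≤ Q v w ^ 2) (hzz : Q z z = 0)
    (hzw : Q z w = 0) (y : V) : Q z y = 0 := by
  have key : ∀ t : ℝ, 2 * t * Q z y * Q w w ≤ t ^ 2 * (Q y w ^ 2 - Q y y * Q w w) := by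
    intro t
    have h := hrev (z + t • y)
    have hs : Q y z = Q z y := hQ.eq y z
    simp only [map_add, map_smul, LinearMap.add_apply, LinearMap.smul_apply, smul_eq_mul, hs,
      hzz, hzw] at h
    linarith
  set K := Q y w ^ 2 - Q y y * Q w w
  set q := Q z y * Q w w with hq
  have hK : 0 ≤ K := by linarith [key 1, key (-1)]
  have hq0 : q = 0 := by
    -- A bound 2tq ≤ t²K for all t forces q = 0; dividing by K + 1 rather than K allows K = 0.
    have h := key (q / (K + 1))
    have h2 : 2 * (q / (K + 1)) * Q z y * Q w w = 2 * q ^ 2 / (K + 1) := by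
      rw [hq]; ring
    rw [h2, div_pow, div_mul_eq_mul_div, div_le_div_iff₀ (by positivity) (by positivity)] at h
    have : q ^ 2 * (K + 1) * (K + 2) ≤ 0 := by nlinarith
    by_contra hne
    have : 0 < q ^ 2 * (K + 1) * (K + 2) := by positivity
    linarith
  exact (mul_eq_zero.1 hq0).resolve_right hw.ne'

/-- The Dirichlet form of a weighted graph with degrees `ρ`. -/
theorem Matrix.sum_degree_mul_sq_sub_dotProduct {α : Type*} [Fintype α] {C : Matrix α α ℝ}
    (hC : C.IsSymm) (v : α → ℝ) :
    ∑ a, (∑ b, C a b) * v a ^ 2 - v ⬝ᵥ C *ᵥ v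
      = (∑ a, ∑ b, C a b * (v a - v b) ^ 2) / 2 := by
  have h1 : ∑ a, ∑ b, C a b * v b ^ 2 = ∑ a, ∑ b, C a b * v a ^ 2 := by
    rw [sum_comm]
    exact sum_congr rfl fun a _ => sum_congr rfl fun b _ => by rw [hC.apply]
  have h2 : v ⬝ᵥ C *ᵥ v = ∑ a, ∑ b, C a b * (v a * v b) := by
    simp only [dotProduct, mulVec, mul_sum]
    exact sum_congr rfl fun a _ => sum_congr rfl fun b _ => by ring
  have h3 : ∑ a, ∑ b, C a b * (v a - v b) ^ 2 = ∑ a, ∑ b, C a b * v a ^ 2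
      + ∑ a, ∑ b, C a b * v b ^ 2 - 2 * ∑ a, ∑ b, C a b * (v a * v b) := by
    simp only [mul_sum, ← sum_add_distrib, ← sum_sub_distrib]
    exact sum_congr rfl fun a _ => sum_congr rfl fun b _ => by ring
  rw [h3, h1, h2]
  simp only [sum_mul]
  ring

/-- A symmetric matrix `S = C - B Bᵀ / A`, with `C` a connected nonnegative matrix of row sums `ρ`,
that satisfies the Bochner-type inequality `S ≤ S ρ⁻¹ S` is negative semidefinite. -/
theorem Matrix.dotProduct_mulVec_nonpos_of_bochner {α : Type*} [Fintype α] [DecidableEq α]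
    {S C : Matrix α α ℝ} {B ρ : α → ℝ} {A : ℝ} (hA : 0 < A) (hC : C.IsSymm)
    (hC0 : ∀ a b, 0 ≤ C a b) (hρ : ∀ a, ρ a = ∑ b, C a b) (hB0 : ∀ a, ρ a = 0 → B a = 0)
    (hB : ∀ a, 0 < ρ a → 0 < B a)
    (hconn : ∀ a b, 0 < ρ a → 0 < ρ b → 0 < C a b ∨ ∃ k, 0 < C a k ∧ 0 < C k b)
    (hS : ∀ a b, S a b = C a b - B a * B b / A)
    (hboch : ∀ v, v ⬝ᵥ S *ᵥ v ≤ ∑ a, (S *ᵥ v) a ^ 2 / ρ a) (v : α → ℝ) :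
    v ⬝ᵥ S *ᵥ v ≤ 0 := by
  have hρ0 : ∀ a, 0 ≤ ρ a := fun a => by rw [hρ]; exact sum_nonneg fun b _ => hC0 a b
  have hCz : ∀ a b, ρ a = 0 → C a b = 0 := fun a b h =>
    (sum_eq_zero_iff_of_nonneg fun b _ => hC0 a b).1 ((hρ a).symm.trans h) b (mem_univ b)
  have hSz : ∀ a b, ρ a = 0 → S a b = 0 := fun a b h => by
    rw [hS, hCz a b h, hB0 a h]; simp
  have hSsymm : ∀ a b, S a b = S b a := fun a b => by
    rw [hS, hS, hC.apply, mul_comm (B a)]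
  have hSz' : ∀ a b, ρ b = 0 → S a b = 0 := fun a b h => by rw [hSsymm, hSz b a h]
  set s : α → ℝ := fun a => √(ρ a) with hs
  have hs0 : ∀ a, s a = 0 → ρ a = 0 := fun a h => (Real.sqrt_eq_zero (hρ0 a)).1 h
  have hss : ∀ a, s a ^ 2 = ρ a := fun a => Real.sq_sqrt (hρ0 a)
  have hSv : ∀ v : α → ℝ, v ⬝ᵥ S *ᵥ v
      = v ⬝ᵥ C *ᵥ v - (∑ a, B a * v a) ^ 2 / A := by
    intro v
    simp only [dotProduct, mulVec, hS, sub_mul, sum_sub_distrib, mul_sub]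
    congr 1
    rw [sq, sum_mul_sum, sum_div]
    refine sum_congr rfl fun a _ => ?_
    rw [mul_sum, sum_div]
    exact sum_congr rfl fun b _ => by ring
  -- This is -ρ^(-1/2) S ρ^(-1/2). Where ρ vanishes, division by zero gives zero entries, in
  -- agreement with the vanishing rows of S.
  set N : Matrix α α ℝ := Matrix.of fun a b => -(S a b / (s a * s b)) with hN
  have hNH : N.IsHermitian := by
    ext a b
    rw [conjTranspose_apply, hN, of_apply, of_apply, star_trivial, hSsymm, mul_comm (s b)]
  have hNu : ∀ u : α → ℝ, ∀ a, (N *ᵥ u) a = -((S *ᵥ fun b => u b / s b) a / s a) := by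
    intro u a
    simp only [mulVec, dotProduct, hN, of_apply, sum_div, ← sum_neg_distrib]
    exact sum_congr rfl fun b _ => by ring
  have hquad : ∀ u : α → ℝ, u ⬝ᵥ N *ᵥ u
      = -((fun a => u a / s a) ⬝ᵥ S *ᵥ fun a => u a / s a) := by
    intro u
    simp only [dotProduct, hNu, ← sum_neg_distrib]
    exact sum_congr rfl fun b _ => by ring
  have heig : ∀ k, 0 ≤ hNH.eigenvalues k := by
    intro k
    set l := hNH.eigenvalues k with hl
    set u : α → ℝ := ⇑(hNH.eigenvectorBasis k) with hu
    have hev : N *ᵥ u = l • u := hNH.mulVec_eigenvectorBasis k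
    have hnorm : ∑ a, u a ^ 2 = 1 := by
      have h := hNH.eigenvectorBasis.orthonormal.1 k
      rw [EuclideanSpace.norm_eq, Real.sqrt_eq_one] at h
      simpa using h
    by_contra! hneg
    set t : α → ℝ := fun a => u a / s a with ht
    have hq : t ⬝ᵥ S *ᵥ t = -l := by
      have h := hquad u
      rw [hev, dotProduct_smul, dotProduct] at h
      have h' : ∑ a, u a * u a = 1 := by rw [← hnorm]; exact sum_congr rfl fun a _ => by ring
      rw [h', smul_eq_mul, mul_one] at h
      linarith
    have hb := hboch t
    have hb2 : ∑ a, (S *ᵥ t) a ^ 2 / ρ a = l ^ 2 := by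
      have : ∀ a, (S *ᵥ t) a ^ 2 / ρ a = l ^ 2 * u a ^ 2 := fun a => by
        have h := congrFun hev a
        rw [hNu, Pi.smul_apply, smul_eq_mul] at h
        rw [← hss, ← div_pow, ← mul_pow, ← h]; ring
      simp_rw [this, ← mul_sum, hnorm, mul_one]
    rw [hq, hb2] at hb
    -- On an eigenvector the Bochner inequality reads -l ≤ l², and -l is positive.
    have hl1 : 1 ≤ -l := by nlinarith
    have hdeg : ∑ a, ρ a * t a ^ 2 ≤ 1 := by
      rw [← hnorm]
      refine sum_le_sum fun a _ => ?_
      by_cases h : s a = 0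
      · rw [hs0 a h, zero_mul]; positivity
      · rw [ht, ← hss]; simp only; rw [div_pow, mul_div_cancel₀]; exact pow_ne_zero 2 h
    have hdir := Matrix.sum_degree_mul_sq_sub_dotProduct hC t
    simp_rw [← hρ] at hdir
    have hterm : ∀ a b, 0 ≤ C a b * (t a - t b) ^ 2 := fun a b =>
      mul_nonneg (hC0 a b) (sq_nonneg _)
    have hsum0 : 0 ≤ ∑ a, ∑ b, C a b * (t a - t b) ^ 2 :=
      sum_nonneg fun a _ => sum_nonneg fun b _ => hterm a b
    have hBt : 0 ≤ (∑ a, B a * t a) ^ 2 / A := by positivity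
    have h4 := hSv t
    -- The value -l of S at t is ∑ ρ t² ≤ 1 minus half the Dirichlet sum and minus (B·t)²/A. As it
    -- is at least 1, both subtracted terms vanish. Then t is constant on the support of ρ, and B·t
    -- = 0 with B positive there makes that constant 0.
    have hdz : ∑ a, ∑ b, C a b * (t a - t b) ^ 2 = 0 := by linarith
    have hBz : (∑ a, B a * t a) ^ 2 / A = 0 := by linarith
    have hBz' : ∑ a, B a * t a = 0 := by
      rcases div_eq_zero_iff.1 hBz with h | h
      · exact pow_eq_zero_iff (two_ne_zero) |>.1 h
      · exact absurd h hA.ne'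
    have hedge : ∀ a b, 0 < C a b → t a = t b := by
      intro a b hab
      have h1 := (sum_eq_zero_iff_of_nonneg fun a _ => sum_nonneg fun b _ => hterm a b).1 hdz a
        (mem_univ a)
      have h2 := (sum_eq_zero_iff_of_nonneg fun b _ => hterm a b).1 h1 b (mem_univ b)
      have h3 := (mul_eq_zero.1 h2).resolve_left hab.ne'
      linarith [pow_eq_zero_iff (two_ne_zero) |>.1 h3]
    have hconst : ∀ a b, 0 < ρ a → 0 < ρ b → t a = t b := by
      intro a b ha hb
      rcases hconn a b ha hb with h | ⟨k, h1, h2⟩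
      · exact hedge a b h
      · exact (hedge a k h1).trans (hedge k b h2)
    have htz : ∀ a, 0 < ρ a → t a = 0 := by
      intro a ha
      have h1 : ∑ b, B b * t b = (∑ b, B b) * t a := by
        rw [sum_mul]
        refine sum_congr rfl fun b _ => ?_
        rcases (hρ0 b).eq_or_lt with h | h
        · rw [hB0 b h.symm]; ring
        · rw [hconst a b ha h]
      have hBn : ∀ b, 0 ≤ B b := fun b => by
        rcases (hρ0 b).eq_or_lt with h | h
        · rw [hB0 b h.symm]
        · exact (hB b h).le
      have h2 : 0 < ∑ b, B b :=
        sum_pos' (fun b _ => hBn b) ⟨a, mem_univ a, hB a ha⟩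
      rw [hBz'] at h1
      exact (mul_eq_zero.1 h1.symm).resolve_left h2.ne'
    have : t ⬝ᵥ S *ᵥ t = 0 := by
      rw [dotProduct]
      refine sum_eq_zero fun a _ => ?_
      rcases (hρ0 a).eq_or_lt with h | h
      · rw [mulVec, dotProduct]
        simp [hSz a _ h.symm]
      · rw [htz a h, zero_mul]
    linarith
  have hpsd : N.PosSemidef := hNH.posSemidef_iff_eigenvalues_nonneg.2 heig
  have h := hpsd.dotProduct_mulVec_nonneg (fun a => v a * s a)
  simp only [star_trivial] at h
  rw [hquad] at h
  have hfin : (fun a => v a * s a / s a) ⬝ᵥ S *ᵥ (fun a => v a * s a / s a) = v ⬝ᵥ S *ᵥ v := by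
    simp only [dotProduct, mulVec, mul_sum]
    refine sum_congr rfl fun a _ => sum_congr rfl fun b _ => ?_
    by_cases ha : s a = 0
    · rw [hSz a b (hs0 a ha)]; ring
    by_cases hb : s b = 0
    · rw [hSz' a b (hs0 b hb)]; ring
    rw [mul_div_cancel_right₀ _ ha, mul_div_cancel_right₀ _ hb]
  linarith

/-! ### Counts of independent sets and Euler identities for their Hessians. -/

namespace Matroid

variable {α : Type*} [Fintype α]

open Classical in
/-- The independent sets of size `s` that contain `X`. -/
noncomputable def indepsContaining (M : Matroid α) (s : ℕ) (X : Finset α) : Finset (Finset α) :=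
  {I | M.Indep (I : Set α) ∧ #I = s ∧ X ⊆ I}

theorem mem_indepsContaining {M : Matroid α} {s : ℕ} {X I : Finset α} :
    I ∈ M.indepsContaining s X ↔ M.Indep (I : Set α) ∧ #I = s ∧ X ⊆ I := by
  simp [indepsContaining]

/-- The number of independent sets of size `s` that contain `X`. -/
noncomputable def indepCount (M : Matroid α) (s : ℕ) (X : Finset α) : ℝ :=
  #(M.indepsContaining s X)

theorem indepCount_nonneg (M : Matroid α) (s : ℕ) (X : Finset α) : 0 ≤ M.indepCount s X :=
  Nat.cast_nonneg _

theorem indepCount_of_not_indep {M : Matroid α} {s : ℕ} {X : Finset α}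
    (hX : ¬ M.Indep (X : Set α)) : M.indepCount s X = 0 := by
  rw [indepCount, Nat.cast_eq_zero, card_eq_zero, eq_empty_iff_forall_notMem]
  intro I hI
  rw [mem_indepsContaining] at hI
  exact hX (hI.1.subset (by exact_mod_cast hI.2.2))

theorem indep_of_indepCount_pos {M : Matroid α} {s : ℕ} {X : Finset α}
    (h : 0 < M.indepCount s X) : M.Indep (X : Set α) := by
  by_contra hX
  exact h.ne' (indepCount_of_not_indep hX)

theorem Indep.exists_finset_superset {M : Matroid α} {s : ℕ} {X : Finset α}
    (hX : M.Indep (X : Set α)) (hs : #X ≤ s) (hr : (s : ℕ∞) ≤ M.eRank) :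
    ∃ I : Finset α, M.Indep (I : Set α) ∧ #I = s ∧ X ⊆ I := by
  obtain ⟨B, hB, hXB⟩ := hX.exists_isBase_superset
  have hfin : B.Finite := B.toFinite
  obtain ⟨B, rfl⟩ := hfin.exists_finset_coe
  have hcard : s ≤ #B := by
    rw [← hB.encard_eq_eRank, Set.encard_coe_eq_coe_finsetCard] at hr
    exact_mod_cast hr
  obtain ⟨I, hXI, hIB, hI⟩ := exists_subsuperset_card_eq (by exact_mod_cast hXB) hs hcard
  exact ⟨I, hB.indep.subset (by exact_mod_cast hIB), hI, hXI⟩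

theorem card_le_of_coe_le_eRank {M : Matroid α} {s : ℕ} (hr : (s : ℕ∞) ≤ M.eRank) : s ≤ Fintype.card α := by
  obtain ⟨I, -, hI, -⟩ :=
    Indep.exists_finset_superset (X := ∅) (by simp) (Nat.zero_le s) hr
  rw [← hI]
  exact card_le_univ I

theorem indepCount_pos {M : Matroid α} {s : ℕ} {X : Finset α}
    (hX : M.Indep (X : Set α)) (hs : #X ≤ s) (hr : (s : ℕ∞) ≤ M.eRank) :
    0 < M.indepCount s X := by
  obtain ⟨I, hI⟩ := hX.exists_finset_superset hs hr
  rw [indepCount, Nat.cast_pos, card_pos]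
  exact ⟨I, mem_indepsContaining.2 hI⟩

theorem indepCount_card_eq_one {M : Matroid α} {X : Finset α} (hX : M.Indep (X : Set α)) :
    M.indepCount #X X = 1 := by
  rw [indepCount, Nat.cast_eq_one, card_eq_one]
  refine ⟨X, ?_⟩
  ext I
  rw [mem_indepsContaining, mem_singleton]
  constructor
  · rintro ⟨-, h1, h2⟩
    exact (eq_of_subset_of_card_le h2 h1.le).symm
  · rintro rfl
    exact ⟨hX, rfl, Subset.rfl⟩

variable [DecidableEq α]

/-- Double counting of pairs `(a, I)` with `a ∈ I \ X`. -/
theorem sum_indepCount_insert (M : Matroid α) (s : ℕ) (X : Finset α) :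
    ∑ a ∈ Xᶜ, M.indepCount s (insert a X) = (s - #X) * M.indepCount s X := by
  have h1 : ∀ a, M.indepCount s (insert a X)
      = ∑ I ∈ M.indepsContaining s X, if a ∈ I then (1 : ℝ) else 0 := by
    intro a
    rw [sum_boole, indepCount]
    congr 2
    ext I
    rw [mem_filter, mem_indepsContaining, mem_indepsContaining, insert_subset_iff]
    tauto
  simp_rw [h1]
  rw [sum_comm, indepCount, mul_comm, ← nsmul_eq_mul]
  refine sum_eq_card_nsmul fun I hI => ?_
  obtain ⟨-, hI, hX⟩ := mem_indepsContaining.1 hI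
  rw [sum_boole, ← hI, ← Nat.cast_sub (card_le_card hX), ← card_sdiff_of_subset hX]
  congr 2
  ext a
  simp [and_comm]

/-- The Hessian, at the origin of the homogenizing variable `none` and at the all-ones vector of
the variables `some a`, of the degree-`(d + 2 - #J)` part of the homogenized generating polynomial
of independent sets of the contraction `M ／ J`. -/
noncomputable def indepHessian (M : Matroid α) (d : ℕ) (J : Finset α) :
    Matrix (Option α) (Option α) ℝ
  | none, none =>
    (Fintype.card α - d) * (Fintype.card α - d - 1) * M.indepCount d J
  | some a, none => if a ∈ J then 0 else (Fintype.card α - d - 1) * M.indepCount (d + 1) (insert a J)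
  | none, some a => if a ∈ J then 0 else (Fintype.card α - d - 1) * M.indepCount (d + 1) (insert a J)
  | some a, some b =>
    if a ∈ J ∨ b ∈ J ∨ a = b then 0 else M.indepCount (d + 2) (insert a (insert b J))

variable {M : Matroid α} {d : ℕ} {J : Finset α}

theorem indepHessian_none_none : M.indepHessian d J none none
    = (Fintype.card α - d) * (Fintype.card α - d - 1) * M.indepCount d J := rfl

theorem indepHessian_none_some (a : α) : M.indepHessian d J none (some a)
    = if a ∈ J then 0 else (Fintype.card α - d - 1) * M.indepCount (d + 1) (insert a J) := rfl

theorem indepHessian_some_none (a : α) : M.indepHessian d J (some a) none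
    = if a ∈ J then 0 else (Fintype.card α - d - 1) * M.indepCount (d + 1) (insert a J) := rfl

theorem indepHessian_some_some (a b : α) : M.indepHessian d J (some a) (some b)
    = if a ∈ J ∨ b ∈ J ∨ a = b then 0 else M.indepCount (d + 2) (insert a (insert b J)) := rfl

theorem indepHessian_isSymm : (M.indepHessian d J).IsSymm := by
  refine IsSymm.ext fun a b => ?_
  rcases a with _ | a <;> rcases b with _ | b
  · rfl
  · rfl
  · rfl
  · rw [indepHessian_some_some, indepHessian_some_some, Finset.insert_comm]
    exact if_congr (by tauto) rfl rfl

theorem indepHessian_some_some_nonneg (a b : α) : 0 ≤ M.indepHessian d J (some a) (some b) := by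
  rw [indepHessian_some_some]
  split_ifs
  exacts [le_rfl, indepCount_nonneg _ _ _]

theorem indepHessian_of_not_indep (hJ : ¬ M.Indep (J : Set α)) : M.indepHessian d J = 0 := by
  have h : ∀ a, ¬ M.Indep (insert a J : Finset α) := fun a h =>
    hJ (h.subset (by exact_mod_cast subset_insert a J))
  have h' : ∀ a b, ¬ M.Indep (insert a (insert b J) : Finset α) := fun a b hi =>
    h b (hi.subset (by exact_mod_cast subset_insert a _))
  ext a b
  rcases a with _ | a <;> rcases b with _ | b
  · simp [indepHessian_none_none, indepCount_of_not_indep hJ]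
  · simp [indepHessian_none_some, indepCount_of_not_indep (h b)]
  · simp [indepHessian_some_none, indepCount_of_not_indep (h a)]
  · simp [indepHessian_some_some, indepCount_of_not_indep (h' a b)]

theorem indepHessian_some_of_not_indep {a : α} (ha : a ∈ J ∨ ¬ M.Indep (insert a J : Finset α))
    (o : Option α) : M.indepHessian d J (some a) o = 0 := by
  rcases ha with ha | ha
  · rcases o with _ | b
    · rw [indepHessian_some_none, if_pos ha]
    · rw [indepHessian_some_some, if_pos (Or.inl ha)]
  · rcases o with _ | b
    · simp [indepHessian_some_none, indepCount_of_not_indep ha]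
    · have : ¬ M.Indep (insert a (insert b J) : Finset α) := fun h =>
        ha (h.subset (by exact_mod_cast insert_subset_insert a (subset_insert b J)))
      simp [indepHessian_some_some, indepCount_of_not_indep this]

/-- Euler's identity for the second derivatives. The weights of the homogenizing row and column
depend on d only, so every entry reduces to the double count `sum_indepCount_insert` with the same
factor d - |J|. -/
theorem sum_indepHessian_insert (M : Matroid α) (d : ℕ) (J : Finset α) :
    ∑ i ∈ Jᶜ, M.indepHessian d (insert i J) = ((d : ℝ) - #J) • M.indepHessian d J := by
  have single : ∀ (s : ℕ) (a : α), a ∉ J →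
      ∑ i ∈ Jᶜ, (if a ∈ insert i J then 0 else M.indepCount (s + 1) (insert a (insert i J)))
        = ((s : ℝ) - #J) * M.indepCount (s + 1) (insert a J) := by
    intro s a ha
    have h := M.sum_indepCount_insert (s + 1) (insert a J)
    rw [card_insert_of_notMem ha] at h
    have hs : (insert a J)ᶜ = {i ∈ Jᶜ | a ∉ insert i J} := by
      ext i; simp only [mem_compl, mem_insert, mem_filter]; grind
    rw [hs, sum_filter] at h
    push_cast at h
    rw [show (s : ℝ) - #J = s + 1 - (#J + 1) by ring, ← h]
    refine sum_congr rfl fun i _ => ?_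
    rw [Finset.insert_comm, ite_not]
  ext o p
  rw [Matrix.sum_apply, Matrix.smul_apply, smul_eq_mul]
  rcases o with _ | a <;> rcases p with _ | b
  · simp only [indepHessian_none_none]
    rw [← mul_sum, sum_indepCount_insert]; ring
  · simp only [indepHessian_none_some]
    by_cases hb : b ∈ J
    · simp [hb]
    · rw [if_neg hb, ← mul_left_comm, ← single d b hb, mul_sum]
      exact sum_congr rfl fun i _ => by split_ifs <;> simp
  · simp only [indepHessian_some_none]
    by_cases hb : a ∈ J
    · simp [hb]
    · rw [if_neg hb, ← mul_left_comm, ← single d a hb, mul_sum]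
      exact sum_congr rfl fun i _ => by split_ifs <;> simp
  · simp only [indepHessian_some_some]
    by_cases h : a ∈ J ∨ b ∈ J ∨ a = b
    · rw [if_pos h, mul_zero]
      refine sum_eq_zero fun i _ => if_pos ?_
      simp only [mem_insert]; tauto
    · rw [if_neg h]
      push Not at h
      have h' := M.sum_indepCount_insert (d + 2) (insert a (insert b J))
      rw [card_insert_of_notMem (by simp [h]), card_insert_of_notMem h.2.1] at h'
      have hs : (insert a (insert b J))ᶜ
          = {i ∈ Jᶜ | ¬ (a ∈ insert i J ∨ b ∈ insert i J ∨ a = b)} := by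
        ext i; simp only [mem_compl, mem_insert, mem_filter]; grind
      rw [hs, sum_filter] at h'
      push_cast at h'
      rw [show (d : ℝ) - #J = d + 2 - (#J + 1 + 1) by ring, ← h']
      refine sum_congr rfl fun i _ => ?_
      rw [ite_not]
      congr 2
      ext x; simp only [mem_insert]; tauto

/-- The indicator vector of the original variables. -/
def nonHomogenizing (α : Type*) : Option α → ℝ
  | none => 0
  | some _ => 1

theorem sum_indepHessian_some (M : Matroid α) (d : ℕ) (J : Finset α) {a : α} (ha : a ∉ J) :
    ∑ b, M.indepHessian d J (some a) (some b)
      = ((d : ℝ) + 1 - #J) * M.indepCount (d + 2) (insert a J) := by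
  have h := M.sum_indepCount_insert (d + 2) (insert a J)
  rw [card_insert_of_notMem ha] at h
  have hs : (insert a J)ᶜ = ({b | ¬ (a ∈ J ∨ b ∈ J ∨ a = b)} : Finset α) := by
    ext i; simp only [mem_compl, mem_insert, mem_filter, mem_univ]; grind
  rw [hs, sum_filter] at h
  push_cast at h
  rw [show (d : ℝ) + 1 - #J = d + 2 - (#J + 1) by ring, ← h]
  refine sum_congr rfl fun b _ => ?_
  rw [indepHessian_some_some, ite_not, Finset.insert_comm]

/-- Euler's identity for third derivatives: contracting the Hessian of ∂ᵢ with the evaluation point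
returns row i of the original Hessian. This converts pairings with H_{J∪i} into coordinates of H_J
z. -/
theorem indepHessian_insert_mulVec (M : Matroid α) (d : ℕ) (J : Finset α) {i : α} (hi : i ∉ J) :
    M.indepHessian d (insert i J) *ᵥ nonHomogenizing α
      = ((d : ℝ) - #J) • M.indepHessian d J (some i) := by
  ext o
  rw [mulVec, dotProduct, Fintype.sum_option, Pi.smul_apply, smul_eq_mul]
  simp only [nonHomogenizing, mul_zero, zero_add, mul_one]
  rcases o with _ | a
  · rw [indepHessian_some_none, if_neg hi, mul_left_comm]
    have h := M.sum_indepCount_insert (d + 1) (insert i J)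
    rw [card_insert_of_notMem hi] at h
    have hs : (insert i J)ᶜ = ({b | ¬ (b ∈ insert i J)} : Finset α) := by
      ext i; simp only [mem_compl, mem_filter, mem_univ, true_and]
    rw [hs, sum_filter] at h
    push_cast at h
    rw [show (d : ℝ) - #J = d + 1 - (#J + 1) by ring, ← h, mul_sum]
    refine sum_congr rfl fun b _ => ?_
    rw [indepHessian_none_some]
    split_ifs <;> simp
  · by_cases ha : a ∈ insert i J
    · rw [indepHessian_some_some, if_pos (by grind), mul_zero]
      exact sum_eq_zero fun b _ => by rw [indepHessian_some_some, if_pos (Or.inl ha)]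
    · rw [sum_indepHessian_some _ _ _ ha, card_insert_of_notMem hi, indepHessian_some_some,
        if_neg (by grind), Finset.insert_comm]
      push_cast
      ring

end Matroid

/-! ### Parallel classes of contractions and the explicit case |J| = d. -/

namespace Matroid

variable {α : Type*}

/-- Two nonloops of M ／ J are parallel there exactly when they span the same flat together with J;
this is the exchange property of closure. -/
theorem Indep.insert_insert_indep_iff_closure_ne {M : Matroid α} {J : Set α} {a b : α}
    (haJ : a ∉ J) (ha : M.Indep (insert a J)) (hb : M.Indep (insert b J)) :
    (a ≠ b ∧ M.Indep (insert a (insert b J))) ↔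
      M.closure (insert b J) ≠ M.closure (insert a J) := by
  have haE : a ∈ M.E := ha.subset_ground (Set.mem_insert _ _)
  have hJ : M.Indep J := ha.subset (Set.subset_insert _ _)
  constructor
  · rintro ⟨hne, hab⟩ heq
    have h1 : a ∉ M.closure (insert b J) :=
      (hb.notMem_closure_iff_of_notMem (by simp [hne, haJ])).2 hab
    rw [heq] at h1
    exact h1 (M.mem_closure_of_mem (Set.mem_insert _ _) ha.subset_ground)
  · intro hne
    have hab : a ≠ b := by rintro rfl; exact hne rfl
    refine ⟨hab, ?_⟩
    rw [← hb.notMem_closure_iff_of_notMem (by simp [hab, haJ])]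
    intro hcl
    have hacl : a ∉ M.closure J := (hJ.notMem_closure_iff_of_notMem haJ).2 ha
    exact hne (M.closure_insert_congr ⟨hcl, hacl⟩).symm

variable [Fintype α]

open Classical in
/-- The nonloops of the contraction of `M` by `J`. -/
noncomputable def contractNonloops (M : Matroid α) (J : Finset α) : Finset α :=
  {a | a ∉ J ∧ M.Indep (insert a (J : Set α))}

theorem mem_contractNonloops {M : Matroid α} {J : Finset α} {a : α} :
    a ∈ M.contractNonloops J ↔ a ∉ J ∧ M.Indep (insert a (J : Set α)) := by
  simp [contractNonloops]

open Classical in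
/-- The parallel class of `a` in the contraction of `M` by `J`. -/
noncomputable def contractClass (M : Matroid α) (J : Finset α) (a : α) : Finset α :=
  {b ∈ M.contractNonloops J | M.closure (insert b (J : Set α)) = M.closure (insert a (J : Set α))}

theorem mem_contractClass {M : Matroid α} {J : Finset α} {a b : α} :
    b ∈ M.contractClass J a ↔ b ∈ M.contractNonloops J ∧
      M.closure (insert b (J : Set α)) = M.closure (insert a (J : Set α)) := by
  simp [contractClass]

variable [DecidableEq α] {M : Matroid α} {d : ℕ} {J : Finset α}

/-- For |J| = d every count is 0 or 1, so this block is the adjacency matrix of the complete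
multipartite graph whose parts are the parallel classes of M ／ J. -/
theorem indepHessian_some_some_of_card_eq (hJd : #J = d) {a : α}
    (ha : a ∈ M.contractNonloops J) (b : α) :
    M.indepHessian d J (some a) (some b) = (if b ∈ M.contractNonloops J then 1 else 0)
      - (if b ∈ M.contractClass J a then 1 else 0) := by
  have ha' := mem_contractNonloops.1 ha
  by_cases hb : b ∈ M.contractNonloops J
  · have hb' := mem_contractNonloops.1 hb
    have key := Indep.insert_insert_indep_iff_closure_ne (by exact_mod_cast ha'.1) ha'.2 hb'.2
    rw [if_pos hb, indepHessian_some_some]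
    by_cases hc : M.closure (insert b (J : Set α)) = M.closure (insert a (J : Set α))
    · rw [if_pos (mem_contractClass.2 ⟨hb, hc⟩), sub_self]
      split_ifs with h
      · rfl
      · refine indepCount_of_not_indep fun hi => key.1 ⟨?_, by exact_mod_cast hi⟩ hc
        tauto
    · obtain ⟨hne, hi⟩ := key.2 hc
      rw [if_neg (fun h => hc (mem_contractClass.1 h).2), sub_zero, if_neg (by tauto)]
      have hcard : #(insert a (insert b J)) = d + 2 := by
        rw [card_insert_of_notMem (by simp [hne, ha'.1]), card_insert_of_notMem hb'.1, hJd]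
      rw [← hcard]
      exact indepCount_card_eq_one (by exact_mod_cast hi)
  · rw [if_neg hb, if_neg (fun h => hb (mem_contractClass.1 h).1), sub_zero,
      ← indepHessian_isSymm.apply]
    refine indepHessian_some_of_not_indep ?_ _
    rw [mem_contractNonloops] at hb
    rw [coe_insert]
    tauto

theorem indepHessian_none_some_of_card_eq (hJd : #J = d) (a : α) :
    M.indepHessian d J none (some a)
      = (Fintype.card α - d - 1) * if a ∈ M.contractNonloops J then 1 else 0 := by
  rw [indepHessian_none_some]
  by_cases ha : a ∈ M.contractNonloops J
  · have ha' := mem_contractNonloops.1 ha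
    rw [if_neg ha'.1, if_pos ha, ← hJd, ← card_insert_of_notMem ha'.1,
      indepCount_card_eq_one (by exact_mod_cast ha'.2)]
  · rw [if_neg ha, mul_zero]
    split_ifs with h
    · rfl
    · rw [mem_contractNonloops] at ha
      rw [indepCount_of_not_indep (by rw [coe_insert]; tauto), mul_zero]

theorem indepHessian_mulVec_some_of_card_eq (hJd : #J = d) {a : α}
    (ha : a ∈ M.contractNonloops J) (z : Option α → ℝ) :
    (M.indepHessian d J *ᵥ z) (some a) = (Fintype.card α - d - 1) * z none
      + ∑ b ∈ M.contractNonloops J, z (some b) - ∑ b ∈ M.contractClass J a, z (some b) := by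
  rw [mulVec, dotProduct, Fintype.sum_option, ← indepHessian_isSymm.apply,
    indepHessian_none_some_of_card_eq hJd, if_pos ha, mul_one, add_sub_assoc]
  congr 1
  simp only [indepHessian_some_some_of_card_eq hJd ha, sub_mul, ite_mul, one_mul, zero_mul,
    sum_sub_distrib, sum_ite_mem, univ_inter]

theorem indepHessian_mulVec_none_of_card_eq (hJ : M.Indep (J : Set α)) (hJd : #J = d)
    (z : Option α → ℝ) :
    (M.indepHessian d J *ᵥ z) none = (Fintype.card α - d - 1) *
      ((Fintype.card α - d) * z none + ∑ b ∈ M.contractNonloops J, z (some b)) := by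
  rw [mulVec, dotProduct, Fintype.sum_option, indepHessian_none_none,
    show M.indepCount d J = 1 by rw [← hJd]; exact indepCount_card_eq_one hJ, mul_add]
  congr 1
  · ring
  · simp only [indepHessian_none_some_of_card_eq hJd, mul_assoc, ite_mul, one_mul, zero_mul,
      ← mul_sum, sum_ite_mem, univ_inter]

theorem dotProduct_indepHessian_mulVec (M : Matroid α) (d : ℕ) (J : Finset α)
    (y z : Option α → ℝ) :
    y ⬝ᵥ M.indepHessian d J *ᵥ z = y none * (M.indepHessian d J *ᵥ z) none
      + ∑ a ∈ M.contractNonloops J, y (some a) * (M.indepHessian d J *ᵥ z) (some a) := by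
  rw [dotProduct, Fintype.sum_option]
  congr 1
  symm
  refine sum_subset (subset_univ _) fun a _ ha => ?_
  rw [mem_contractNonloops] at ha
  have : (M.indepHessian d J *ᵥ z) (some a) = 0 :=
    sum_eq_zero fun o _ => by
      beta_reduce
      rw [indepHessian_some_of_not_indep (by rw [coe_insert]; tauto), zero_mul]
  rw [this, mul_zero]

/-- Negative semidefiniteness on the hyperplane orthogonal to the homogenizing direction. -/
def HasLorentzianHessian (M : Matroid α) (d : ℕ) (J : Finset α) : Prop :=
  ∀ z, (M.indepHessian d J *ᵥ z) none = 0 → z ⬝ᵥ M.indepHessian d J *ᵥ z ≤ 0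

/-- Let m = n - d, let V be the sum of z over the nonloops of M ／ J and s_P its sum over a class P.
On the hyperplane m z₀ = -V, so m times the form equals V² - m ∑ s_P². This is nonpositive by
Cauchy–Schwarz, since there are at most m classes. -/
theorem hasLorentzianHessian_of_card_eq (hJ : M.Indep (J : Set α)) (hJd : #J = d)
    (hr : ((d + 2 : ℕ) : ℕ∞) ≤ M.eRank) : M.HasLorentzianHessian d J := by
  classical
  intro z hz
  have hn : (d : ℝ) + 2 ≤ Fintype.card α := by exact_mod_cast card_le_of_coe_le_eRank hr
  rw [dotProduct_indepHessian_mulVec, hz, mul_zero, zero_add]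
  rw [indepHessian_mulVec_none_of_card_eq hJ hJd] at hz
  set m : ℝ := Fintype.card α - d with hm
  set L := M.contractNonloops J
  set κ : α → Set α := fun a => M.closure (insert a (J : Set α)) with hκ
  set V := ∑ b ∈ L, z (some b) with hV
  have hx : m * z none + V = 0 := (mul_eq_zero.1 hz).resolve_left (by linarith)
  set s : Set α → ℝ := fun P => ∑ b ∈ L with κ b = P, z (some b) with hs
  have hVs : ∑ P ∈ L.image κ, s P = V :=
    sum_fiberwise_of_maps_to (fun a ha => mem_image_of_mem κ ha) _
  have hclass : ∀ a, ∑ b ∈ M.contractClass J a, z (some b) = s (κ a) := fun a => by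
    rw [hs]
    exact sum_congr (by ext b; rw [mem_contractClass, mem_filter]) fun _ _ => rfl
  have hsq : ∑ a ∈ L, z (some a) * s (κ a) = ∑ P ∈ L.image κ, s P ^ 2 := by
    rw [← sum_fiberwise_of_maps_to (g := κ) (fun a ha => mem_image_of_mem κ ha)]
    refine sum_congr rfl fun P _ => ?_
    rw [sq, hs]
    simp only
    rw [sum_mul]
    exact sum_congr rfl fun a ha => by rw [(mem_filter.1 ha).2]
  have hcs : V ^ 2 ≤ m * ∑ P ∈ L.image κ, s P ^ 2 := by
    rw [← hVs]
    refine sq_sum_le_card_mul_sum_sq.trans ?_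
    gcongr
    have h1 : #(L.image κ) ≤ #Jᶜ :=
      card_image_le.trans (card_le_card fun a ha => mem_compl.2 (mem_contractNonloops.1 ha).1)
    have h2 : (#Jᶜ : ℝ) = m := by
      rw [card_compl, Nat.cast_sub (card_le_univ J), hJd]
    rw [← h2]
    exact_mod_cast h1
  have hrow : ∑ a ∈ L, z (some a) * (M.indepHessian d J *ᵥ z) (some a)
      = V * ((m - 1) * z none + V) - ∑ P ∈ L.image κ, s P ^ 2 := by
    rw [← hsq, hV, sum_mul, ← sum_sub_distrib]
    refine sum_congr rfl fun a ha => ?_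
    rw [indepHessian_mulVec_some_of_card_eq hJd ha, hclass]
    ring
  rw [hrow]
  have hmpos : 0 < m := by linarith
  have : m * (V * ((m - 1) * z none + V) - ∑ P ∈ L.image κ, s P ^ 2) ≤ 0 := by
    have : z none * m = -V := by linarith
    have e : m * (V * ((m - 1) * z none + V)) = V ^ 2 := by
      linear_combination V * (m - 1) * this
    rw [mul_sub, e]
    linarith
  exact nonpos_of_mul_nonpos_right this hmpos

end Matroid

/-! ### The induction on d - |J| and the propagation of kernels. -/

namespace Matroid

variable {α : Type*} [Fintype α] [DecidableEq α] {M : Matroid α} {d : ℕ} {J : Finset α}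

theorem dotProduct_indepHessian_mulVec_comm (y z : Option α → ℝ) :
    y ⬝ᵥ M.indepHessian d J *ᵥ z = z ⬝ᵥ M.indepHessian d J *ᵥ y := by
  rw [dotProduct_mulVec, ← mulVec_transpose, indepHessian_isSymm.eq, dotProduct_comm]

theorem toBilin'_indepHessian_isSymm : (toBilin' (M.indepHessian d J)).IsSymm :=
  isSymm_toBilin'_iff_isSymm.2 indepHessian_isSymm

theorem HasLorentzianHessian.mul_le_sq (h : M.HasLorentzianHessian d J) {w : Option α → ℝ}
    (hw : 0 ≤ w ⬝ᵥ M.indepHessian d J *ᵥ w) (v : Option α → ℝ) :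
    (v ⬝ᵥ M.indepHessian d J *ᵥ v) * (w ⬝ᵥ M.indepHessian d J *ᵥ w)
      ≤ (v ⬝ᵥ M.indepHessian d J *ᵥ w) ^ 2 := by
  have := LinearMap.BilinForm.mul_le_sq_of_nonpos_on_orthogonal
    (toBilin'_indepHessian_isSymm (M := M) (d := d) (J := J)) (u := Pi.single none 1) (w := w)
    (fun z hz => ?_) (by rwa [toBilin'_apply']) v
  · simpa only [toBilin'_apply'] using this
  · rw [toBilin'_apply', dotProduct_indepHessian_mulVec_comm, single_one_dotProduct] at hz
    rw [toBilin'_apply']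
    exact h z hz

theorem HasLorentzianHessian.mulVec_eq_zero (h : M.HasLorentzianHessian d J)
    {w z : Option α → ℝ} (hw : 0 < w ⬝ᵥ M.indepHessian d J *ᵥ w)
    (hzz : z ⬝ᵥ M.indepHessian d J *ᵥ z = 0) (hzw : z ⬝ᵥ M.indepHessian d J *ᵥ w = 0) :
    M.indepHessian d J *ᵥ z = 0 := by
  ext o
  have := LinearMap.BilinForm.eq_zero_of_isotropic_of_mul_le_sq
    (toBilin'_indepHessian_isSymm (M := M) (d := d) (J := J)) (w := w) (z := z)
    (by rwa [toBilin'_apply'])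
    (fun v => by simpa only [toBilin'_apply'] using h.mul_le_sq hw.le v)
    (by rwa [toBilin'_apply']) (by rwa [toBilin'_apply']) (Pi.single o 1)
  rwa [toBilin'_apply', dotProduct_indepHessian_mulVec_comm, single_one_dotProduct] at this

theorem sum_indepHessian_some_pos (hr : ((d + 2 : ℕ) : ℕ∞) ≤ M.eRank) (hJd : #J ≤ d) {i : α}
    (hi : i ∈ M.contractNonloops J) : 0 < ∑ b, M.indepHessian d J (some i) (some b) := by
  obtain ⟨hiJ, hi⟩ := mem_contractNonloops.1 hi
  have hJd' : (#J : ℝ) ≤ d := by exact_mod_cast hJd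
  rw [sum_indepHessian_some _ _ _ hiJ]
  refine mul_pos (by linarith) (indepCount_pos (by exact_mod_cast hi) ?_ hr)
  rw [card_insert_of_notMem hiJ]
  omega

theorem indepHessian_some_of_notMem_contractNonloops {i : α} (hi : i ∉ M.contractNonloops J)
    (o : Option α) : M.indepHessian d J (some i) o = 0 := by
  rw [mem_contractNonloops] at hi
  exact indepHessian_some_of_not_indep (by rw [coe_insert]; tauto) o

theorem sum_dotProduct_indepHessian_insert (M : Matroid α) (d : ℕ) (J : Finset α)
    (z : Option α → ℝ) :
    ∑ i ∈ M.contractNonloops J, z ⬝ᵥ M.indepHessian d (insert i J) *ᵥ z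
      = ((d : ℝ) - #J) * (z ⬝ᵥ M.indepHessian d J *ᵥ z) := by
  have h := congrArg (fun A => z ⬝ᵥ A *ᵥ z) (M.sum_indepHessian_insert d J)
  simp only [sum_mulVec, dotProduct_sum, smul_mulVec, dotProduct_smul, smul_eq_mul] at h
  rw [← h]
  refine sum_subset (fun i hi => mem_compl.2 (mem_contractNonloops.1 hi).1) fun i hi hi' => ?_
  rw [mem_contractNonloops] at hi'
  rw [indepHessian_of_not_indep, zero_mulVec, dotProduct_zero]
  rw [coe_insert]
  rw [mem_compl] at hi
  tauto

theorem dotProduct_indepHessian_insert_nonHomogenizing {i : α} (hi : i ∉ J)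
    (z : Option α → ℝ) :
    z ⬝ᵥ M.indepHessian d (insert i J) *ᵥ nonHomogenizing α
      = ((d : ℝ) - #J) * (M.indepHessian d J *ᵥ z) (some i) := by
  rw [indepHessian_insert_mulVec _ _ _ hi, dotProduct_smul, smul_eq_mul, dotProduct_comm]
  rfl

theorem nonHomogenizing_dotProduct_indepHessian_insert {i : α} (hi : i ∉ J) :
    nonHomogenizing α ⬝ᵥ M.indepHessian d (insert i J) *ᵥ nonHomogenizing α
      = ((d : ℝ) - #J) * ∑ b, M.indepHessian d J (some i) (some b) := by
  rw [dotProduct_indepHessian_insert_nonHomogenizing hi, mulVec, dotProduct, Fintype.sum_option]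
  simp [nonHomogenizing]

/-- The Bochner-type inequality: the Hessian is dominated by its square. -/
theorem dotProduct_indepHessian_le (hr : ((d + 2 : ℕ) : ℕ∞) ≤ M.eRank) (hJd : #J < d)
    (hins : ∀ i ∈ M.contractNonloops J, M.HasLorentzianHessian d (insert i J))
    (z : Option α → ℝ) :
    z ⬝ᵥ M.indepHessian d J *ᵥ z ≤ ∑ a, (M.indepHessian d J *ᵥ z) (some a) ^ 2 /
      ∑ b, M.indepHessian d J (some a) (some b) := by
  have hc : (0 : ℝ) < d - #J := sub_pos.2 (by exact_mod_cast hJd)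
  refine le_of_mul_le_mul_left ?_ hc
  rw [← sum_dotProduct_indepHessian_insert, mul_sum]
  calc _ ≤ ∑ i ∈ M.contractNonloops J, ((d : ℝ) - #J) *
        ((M.indepHessian d J *ᵥ z) (some i) ^ 2 / ∑ b, M.indepHessian d J (some i) (some b)) := by
        refine sum_le_sum fun i hi => ?_
        have hiJ := (mem_contractNonloops.1 hi).1
        have hρ := sum_indepHessian_some_pos hr hJd.le hi
        have hww := nonHomogenizing_dotProduct_indepHessian_insert (M := M) (d := d) hiJ
        -- Against the evaluation point, Euler's identity turns the mixed term into (H_J z)ᵢ and the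
        -- norm of the evaluation point into the row sum ρᵢ, each up to the factor d - |J|.
        have h := (hins i hi).mul_le_sq (w := nonHomogenizing α)
          (by rw [hww]; positivity) z
        rw [hww, dotProduct_indepHessian_insert_nonHomogenizing hiJ] at h
        rw [← mul_div_assoc, le_div_iff₀ hρ]
        refine le_of_mul_le_mul_left ?_ hc
        linarith
    _ ≤ _ := by
        refine sum_le_sum_of_subset_of_nonneg (subset_univ _) fun i _ _ => ?_
        exact mul_nonneg hc.le (div_nonneg (sq_nonneg _)
          (sum_nonneg fun b _ => indepHessian_some_some_nonneg i b))

theorem hasLorentzianHessian_of_insert (hJ : M.Indep (J : Set α))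
    (hr : ((d + 2 : ℕ) : ℕ∞) ≤ M.eRank) (hJd : #J < d)
    (hins : ∀ i ∈ M.contractNonloops J, M.HasLorentzianHessian d (insert i J)) :
    M.HasLorentzianHessian d J := by
  have hn : (d : ℝ) + 2 ≤ Fintype.card α := by exact_mod_cast card_le_of_coe_le_eRank hr
  set H := M.indepHessian d J with hH
  have hle : ∀ {s : ℕ}, s ≤ d + 2 → (s : ℕ∞) ≤ M.eRank := fun h =>
    le_trans (by exact_mod_cast h) hr
  have hA : 0 < H none none := by
    rw [hH, indepHessian_none_none]
    have := indepCount_pos hJ hJd.le (hle (by omega))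
    exact mul_pos (mul_pos (by linarith) (by linarith)) this
  have hρ : ∀ a, 0 < ∑ b, H (some a) (some b) → a ∈ M.contractNonloops J := by
    intro a ha
    by_contra h
    simp [hH, indepHessian_some_of_notMem_contractNonloops h] at ha
  have hpos : ∀ a b, a ∉ J → b ∉ J → a ≠ b → M.Indep (insert a (insert b (J : Set α))) →
      0 < H (some a) (some b) := by
    intro a b ha hb hab hi
    rw [hH, indepHessian_some_some, if_neg (by tauto)]
    refine indepCount_pos (by exact_mod_cast hi) ?_ hr
    rw [card_insert_of_notMem (by simp [hab, ha]), card_insert_of_notMem hb]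
    omega
  -- The Schur complement of the homogenizing entry: the form restricted to the hyperplane, in the
  -- original coordinates.
  set S : Matrix α α ℝ := Matrix.of fun a b =>
    H (some a) (some b) - H none (some a) * H none (some b) / H none none with hS
  have hsz : ∀ z : Option α → ℝ, (H *ᵥ z) none = 0 →
      ∀ a, (H *ᵥ z) (some a) = (S *ᵥ fun b => z (some b)) a := by
    intro z hz a
    simp only [mulVec, dotProduct, Fintype.sum_option] at hz ⊢
    simp only [hS, of_apply, sub_mul, sum_sub_distrib]
    have h2 : ∑ b, H none (some a) * H none (some b) / H none none * z (some b)
        = H none (some a) / H none none * ∑ b, H none (some b) * z (some b) := by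
      rw [mul_sum]; exact sum_congr rfl fun b _ => by ring
    rw [h2, show ∑ b, H none (some b) * z (some b) = -(H none none * z none) by linarith,
      show H (some a) none = H none (some a) from indepHessian_isSymm.apply _ _]
    field_simp
    ring
  have hqz : ∀ z : Option α → ℝ, (H *ᵥ z) none = 0 →
      z ⬝ᵥ H *ᵥ z = (fun b => z (some b)) ⬝ᵥ S *ᵥ fun b => z (some b) := by
    intro z hz
    rw [dotProduct, Fintype.sum_option, hz, mul_zero, zero_add, dotProduct]
    exact sum_congr rfl fun a _ => by rw [hsz z hz]
  intro z hz
  rw [← hH] at hz ⊢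
  rw [hqz z hz]
  refine Matrix.dotProduct_mulVec_nonpos_of_bochner
    (C := Matrix.of fun a b => H (some a) (some b)) (B := fun a => H none (some a))
    (ρ := fun a => ∑ b, H (some a) (some b)) hA
    (IsSymm.ext fun a b => (indepHessian_isSymm.apply (some a) (some b) : H _ _ = H _ _))
    (fun a b => indepHessian_some_some_nonneg a b) (fun a => rfl) ?_ ?_ ?_ (fun a b => rfl) ?_ _
  · intro a ha
    have : a ∉ M.contractNonloops J := fun h =>
      (sum_indepHessian_some_pos hr hJd.le h).ne' ha
    exact (indepHessian_isSymm.apply _ _).trans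
      (indepHessian_some_of_notMem_contractNonloops this none)
  · intro a ha
    obtain ⟨haJ, hi⟩ := mem_contractNonloops.1 (hρ a ha)
    rw [hH, indepHessian_none_some, if_neg haJ]
    refine mul_pos (by linarith) (indepCount_pos (by exact_mod_cast hi) ?_ (hle (by omega)))
    rw [card_insert_of_notMem haJ]
    omega
  · intro a b ha hb
    obtain ⟨haJ, hai⟩ := mem_contractNonloops.1 (hρ a ha)
    obtain ⟨hbJ, hbi⟩ := mem_contractNonloops.1 (hρ b hb)
    by_cases hcl : M.closure (insert b (J : Set α)) = M.closure (insert a (J : Set α))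
    · right
      -- Parallel elements are not adjacent, but any neighbour k of a lies outside their common
      -- class and is therefore also a neighbour of b.
      obtain ⟨k, hk⟩ : ∃ k, 0 < H (some a) (some k) := by
        by_contra! h
        exact absurd ha (sum_nonpos fun k _ => h k).not_gt
      have hkL : k ∈ M.contractNonloops J := by
        by_contra h
        have := indepHessian_some_of_notMem_contractNonloops (d := d) h (some a)
        rw [← indepHessian_isSymm.apply] at this
        exact hk.ne' this
      obtain ⟨hkJ, hki⟩ := mem_contractNonloops.1 hkL
      refine ⟨k, hk, ?_⟩
      have hak : a ≠ k ∧ M.Indep (insert a (insert k (J : Set α))) := by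
        rw [hH, indepHessian_some_some] at hk
        split_ifs at hk with h
        · exact absurd hk (lt_irrefl _)
        · exact ⟨by tauto, by exact_mod_cast indep_of_indepCount_pos hk⟩
      have h1 := (Indep.insert_insert_indep_iff_closure_ne (by simpa using haJ) hai hki).1 hak
      rw [← hcl] at h1
      obtain ⟨h2, h3⟩ :=
        (Indep.insert_insert_indep_iff_closure_ne (by simpa using hkJ) hki hbi).2 h1.symm
      exact hpos k b hkJ hbJ h2 h3
    · left
      obtain ⟨h2, h3⟩ :=
        (Indep.insert_insert_indep_iff_closure_ne (by simpa using haJ) hai hbi).2 hcl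
      exact hpos a b haJ hbJ h2 h3
  · intro v
    -- The homogenizing coordinate is the one that lifts v into the hyperplane.
    set y : Option α → ℝ := fun o => o.elim (-(∑ b, H none (some b) * v b) / H none none) v with hy
    have hy0 : (H *ᵥ y) none = 0 := by
      simp only [mulVec, dotProduct, Fintype.sum_option, hy, Option.elim]
      rw [mul_div_cancel₀ _ hA.ne']
      ring
    have h := dotProduct_indepHessian_le hr hJd hins y
    rw [← hH, hqz y hy0] at h
    simp only [hsz y hy0] at h
    exact h

/-- The homogenized generating polynomials of independent sets are Lorentzian. -/
theorem hasLorentzianHessian (hr : ((d + 2 : ℕ) : ℕ∞) ≤ M.eRank) (hJ : M.Indep (J : Set α))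
    (hJd : #J ≤ d) : M.HasLorentzianHessian d J := by
  induction h : d - #J generalizing J with
  | zero => exact hasLorentzianHessian_of_card_eq hJ (by omega) hr
  | succ k ih =>
    refine hasLorentzianHessian_of_insert hJ hr (by omega) fun i hi => ?_
    obtain ⟨hiJ, hi⟩ := mem_contractNonloops.1 hi
    have := card_insert_of_notMem hiJ
    exact ih (by exact_mod_cast hi) (by omega) (by omega)

/-- By Euler's identity z is orthogonal to the evaluation point under each H_{J∪i}, so each of those
forms is nonpositive at z. Their sum is a multiple of the form H_J at z, which is zero, so each
vanishes; z is then isotropic and orthogonal to a positive vector. -/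
theorem indepHessian_insert_mulVec_eq_zero (hr : ((d + 2 : ℕ) : ℕ∞) ≤ M.eRank) (hJd : #J < d)
    {z : Option α → ℝ} (hz : M.indepHessian d J *ᵥ z = 0) {i : α}
    (hi : i ∈ M.contractNonloops J) :
    M.indepHessian d (insert i J) *ᵥ z = 0 := by
  have hc : (0 : ℝ) < d - #J := sub_pos.2 (by exact_mod_cast hJd)
  have hL : ∀ i ∈ M.contractNonloops J, M.HasLorentzianHessian d (insert i J) ∧
      0 < nonHomogenizing α ⬝ᵥ M.indepHessian d (insert i J) *ᵥ nonHomogenizing α ∧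
      z ⬝ᵥ M.indepHessian d (insert i J) *ᵥ nonHomogenizing α = 0 := by
    intro i hi
    obtain ⟨hiJ, hi'⟩ := mem_contractNonloops.1 hi
    refine ⟨hasLorentzianHessian hr (by exact_mod_cast hi')
      (by rw [card_insert_of_notMem hiJ]; omega), ?_, ?_⟩
    · rw [nonHomogenizing_dotProduct_indepHessian_insert hiJ]
      exact mul_pos hc (sum_indepHessian_some_pos hr hJd.le hi)
    · rw [dotProduct_indepHessian_insert_nonHomogenizing hiJ, hz, Pi.zero_apply, mul_zero]
  have hsum := M.sum_dotProduct_indepHessian_insert d J z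
  rw [hz, dotProduct_zero, mul_zero] at hsum
  have hnonpos : ∀ i ∈ M.contractNonloops J, z ⬝ᵥ M.indepHessian d (insert i J) *ᵥ z ≤ 0 := by
    intro i hi
    obtain ⟨h1, h2, h3⟩ := hL i hi
    have h := h1.mul_le_sq h2.le z
    rw [h3, zero_pow two_ne_zero] at h
    exact nonpos_of_mul_nonpos_left h h2
  obtain ⟨h1, h2, h3⟩ := hL i hi
  exact h1.mulVec_eq_zero h2 ((sum_eq_zero_iff_of_nonpos hnonpos).1 hsum i hi) h3

theorem indepHessian_mulVec_eq_zero_of_empty (hr : ((d + 2 : ℕ) : ℕ∞) ≤ M.eRank)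
    {z : Option α → ℝ} (hz : M.indepHessian d ∅ *ᵥ z = 0) (hJ : M.Indep (J : Set α))
    (hJd : #J ≤ d) : M.indepHessian d J *ᵥ z = 0 := by
  induction J using Finset.induction_on with
  | empty => exact hz
  | insert i J hi ih =>
    rw [card_insert_of_notMem hi] at hJd
    rw [coe_insert] at hJ
    exact indepHessian_insert_mulVec_eq_zero hr (by omega)
      (ih (hJ.subset (Set.subset_insert _ _)) (by omega)) (mem_contractNonloops.2 ⟨hi, hJ⟩)

end Matroid

/-! ### Ultra-log-concavity equality and the girth. -/

namespace Matroid

theorem isBase_coe_iff {α : Type*} {M : Matroid α} {r : ℕ} (hr : M.eRank = r) {B : Finset α} :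
    M.IsBase (B : Set α) ↔ M.Indep (B : Set α) ∧ #B = r := by
  constructor
  · intro hB
    refine ⟨hB.indep, ?_⟩
    have := hB.encard_eq_eRank
    rw [hr, Set.encard_coe_eq_coe_finsetCard] at this
    exact_mod_cast this
  · rintro ⟨hB, hBr⟩
    refine hB.isBase_of_eRk_ge B.finite_toSet ?_
    rw [hB.eRk_eq_encard, Set.encard_coe_eq_coe_finsetCard, hr, hBr]

variable {α : Type*} [Fintype α] {M : Matroid α}

theorem numIndep_eq_indepCount (M : Matroid α) (k : ℕ) :
    (M.numIndep k : ℝ) = M.indepCount k ∅ := by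
  rw [numIndep, indepCount, ← Set.ncard_coe_finset,
    ← Set.ncard_image_of_injective _ (coe_injective (α := α))]
  congr 2
  ext I
  constructor
  · rintro ⟨hI, hk⟩
    obtain ⟨I, rfl⟩ := I.toFinite.exists_finset_coe
    rw [Set.encard_coe_eq_coe_finsetCard] at hk
    exact ⟨I, mem_indepsContaining.2 ⟨hI, by exact_mod_cast hk, empty_subset _⟩, rfl⟩
  · rintro ⟨I, hI, rfl⟩
    obtain ⟨hI, hk, -⟩ := mem_indepsContaining.1 hI
    exact ⟨hI, by rw [Set.encard_coe_eq_coe_finsetCard, hk]⟩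

theorem numBasesContaining_eq_indepCount {r : ℕ} (hr : M.eRank = r) (X : Finset α) :
    (M.numBasesContaining (X : Set α) : ℝ) = M.indepCount r X := by
  rw [numBasesContaining, indepCount, ← Set.ncard_coe_finset,
    ← Set.ncard_image_of_injective _ (coe_injective (α := α))]
  congr 2
  ext I
  constructor
  · rintro ⟨hI, hX⟩
    obtain ⟨I, rfl⟩ := I.toFinite.exists_finset_coe
    obtain ⟨hI, hIr⟩ := (isBase_coe_iff hr).1 hI
    exact ⟨I, mem_indepsContaining.2 ⟨hI, hIr, by exact_mod_cast hX⟩, rfl⟩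
  · rintro ⟨I, hI, rfl⟩
    obtain ⟨hI, hk, hX⟩ := mem_indepsContaining.1 hI
    exact ⟨(isBase_coe_iff hr).2 ⟨hI, hk⟩, by exact_mod_cast hX⟩

theorem lt_girth_iff {k : ℕ} :
    (k : ℕ∞) < M.girth ↔ ∀ C : Finset α, M.IsCircuit (C : Set α) → k < #C := by
  rw [← ENat.add_one_le_iff (ENat.natCast_ne_top k), girth, le_sInf_iff]
  constructor
  · intro h C hC
    have := h _ ⟨C, hC, rfl⟩
    rw [Set.encard_coe_eq_coe_finsetCard] at this
    exact_mod_cast this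
  · rintro h _ ⟨C, hC, rfl⟩
    obtain ⟨C, rfl⟩ := C.toFinite.exists_finset_coe
    rw [Set.encard_coe_eq_coe_finsetCard]
    exact_mod_cast h C hC

theorem indep_of_card_lt_girth (hE : M.E = Set.univ) {X : Finset α}
    (hX : (#X : ℕ∞) < M.girth) : M.Indep (X : Set α) := by
  by_contra h
  obtain ⟨C, hCX, hC⟩ := Dep.exists_isCircuit_subset (M := M) (X := X)
    ⟨h, by rw [hE]; exact Set.subset_univ _⟩
  obtain ⟨C, rfl⟩ := C.toFinite.exists_finset_coe
  exact (lt_girth_iff.1 hX C hC).not_ge (card_le_card (by exact_mod_cast hCX))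

variable [DecidableEq α] {d : ℕ} {J : Finset α}

theorem sum_indepCount_singleton (M : Matroid α) (s : ℕ) :
    ∑ a, M.indepCount s {a} = s * M.indepCount s ∅ := by
  simpa using M.sum_indepCount_insert s ∅

theorem sum_indepHessian_empty_some (M : Matroid α) (d : ℕ) (a : α) :
    ∑ b, M.indepHessian d ∅ (some a) (some b) = (d + 1) * M.indepCount (d + 2) {a} := by
  simpa using M.sum_indepHessian_some d ∅ (notMem_empty a)

theorem sum_indepHessian_empty_none (M : Matroid α) (d : ℕ) :
    ∑ b, M.indepHessian d ∅ none (some b)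
      = (Fintype.card α - d - 1) * ((d + 1) * M.indepCount (d + 1) ∅) := by
  have h := M.sum_indepCount_singleton (d + 1)
  push_cast at h
  simp only [indepHessian_none_some, notMem_empty, if_false, ← mul_sum, insert_empty_eq, h]

/-- The equality case of the ultra-log-concavity inequality forces all the contractions by
independent sets of size `d` to be simple. -/
theorem indep_insert_insert_of_indepCount_eq (hr : ((d + 2 : ℕ) : ℕ∞) ≤ M.eRank)
    (heq : (Fintype.card α - d) * (d + 2) * (M.indepCount d ∅ * M.indepCount (d + 2) ∅)
      = (Fintype.card α - d - 1) * (d + 1) * M.indepCount (d + 1) ∅ ^ 2)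
    (hJ : M.Indep (J : Set α)) (hJd : #J = d) {a b : α} (ha : a ∉ J) (hb : b ∉ J)
    (hab : a ≠ b) : M.Indep (insert a (insert b (J : Set α))) := by
  have hn : (d : ℝ) + 2 ≤ Fintype.card α := by exact_mod_cast card_le_of_coe_le_eRank hr
  have hle : ∀ {s : ℕ}, s ≤ d + 2 → (s : ℕ∞) ≤ M.eRank := fun h =>
    le_trans (by exact_mod_cast h) hr
  have hempty : M.Indep ((∅ : Finset α) : Set α) := by simp
  have hI0 := indepCount_pos hempty (Nat.zero_le d) (hle (by omega))
  have hI1 := indepCount_pos hempty (Nat.zero_le (d + 1)) (hle (by omega))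
  set A := M.indepHessian d ∅ none none with hA
  have hA' : A = (Fintype.card α - d) * (Fintype.card α - d - 1) * M.indepCount d ∅ :=
    indepHessian_none_none
  have hApos : 0 < A := by
    rw [hA']; exact mul_pos (mul_pos (by linarith) (by linarith)) hI0
  have hB := M.sum_indepHessian_empty_none d
  set B := ∑ b, M.indepHessian d ∅ none (some b)
  have hBpos : 0 < B := by
    rw [hB]; exact mul_pos (by linarith) (mul_pos (by positivity) hI1)
  -- The lift of the all-ones vector to the hyperplane orthogonal to the homogenizing direction; its
  -- norm vanishes exactly because of `heq`.
  set z : Option α → ℝ := fun o => o.elim (-B / A) fun _ => 1 with hz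
  have hz0 : (M.indepHessian d ∅ *ᵥ z) none = 0 := by
    simp only [mulVec, dotProduct, Fintype.sum_option, hz, Option.elim, mul_one]
    rw [mul_div_cancel₀ _ hApos.ne']
    exact neg_add_cancel B
  have hzz : z ⬝ᵥ M.indepHessian d ∅ *ᵥ z = 0 := by
    rw [dotProduct, Fintype.sum_option, hz0, mul_zero, zero_add]
    have h1 : ∀ a, z (some a) * (M.indepHessian d ∅ *ᵥ z) (some a)
        = M.indepHessian d ∅ none (some a) * (-B / A)
          + (d + 1) * M.indepCount (d + 2) {a} := by
      intro a
      rw [← sum_indepHessian_empty_some, mulVec, dotProduct, Fintype.sum_option,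
        indepHessian_isSymm.apply]
      simp [hz]
    have h2 := M.sum_indepCount_singleton (d + 2)
    push_cast at h2
    rw [sum_congr rfl fun a _ => h1 a, sum_add_distrib, ← sum_mul, ← mul_sum, h2]
    change B * (-B / A) + _ = 0
    have h3 : B * B = A * ((d + 1) * ((d + 2) * M.indepCount (d + 2) ∅)) := by
      rw [hA', hB]
      linear_combination (-(Fintype.card α - d - 1 : ℝ) * (d + 1)) * heq
    rw [mul_div_assoc', mul_neg, h3]
    field_simp
    ring
  have hker := (hasLorentzianHessian hr hempty (Nat.zero_le d)).mulVec_eq_zero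
    (w := Pi.single none 1) (z := z) (by simpa using hApos) hzz
    (by rw [dotProduct_indepHessian_mulVec_comm, single_one_dotProduct, hz0])
  have hkerJ := indepHessian_mulVec_eq_zero_of_empty hr hker hJ hJd.le
  have hrow0 := indepHessian_mulVec_none_of_card_eq hJ hJd z
  rw [hkerJ] at hrow0
  have hx : (Fintype.card α - d) * z none + #(M.contractNonloops J) = 0 := by
    have := (mul_eq_zero.1 hrow0.symm).resolve_left (by linarith)
    simpa [hz] using this
  have hsub : M.contractNonloops J ⊆ Jᶜ := fun a ha => mem_compl.2 (mem_contractNonloops.1 ha).1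
  have hcardc : (#Jᶜ : ℝ) = Fintype.card α - d := by
    rw [card_compl, Nat.cast_sub (card_le_univ J), hJd]
  -- Eliminating z₀ between the homogenizing row and row a. As the nonloops lie in the complement of
  -- J, every class must be a singleton and every element outside J a nonloop, once a nonloop
  -- exists.
  have hclass : ∀ a ∈ M.contractNonloops J,
      (#Jᶜ : ℝ) * #(M.contractClass J a) = #(M.contractNonloops J) := by
    intro a ha
    have h := indepHessian_mulVec_some_of_card_eq hJd ha z
    rw [hkerJ] at h
    have h' : 0 = (Fintype.card α - d - 1) * z none + #(M.contractNonloops J)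
        - #(M.contractClass J a) := by simpa [hz] using h
    rw [hcardc]
    linear_combination (Fintype.card α - d : ℝ) * h' + (Fintype.card α - d - 1 : ℝ) * hx
  have hclass' : ∀ a ∈ M.contractNonloops J,
      #(M.contractClass J a) = 1 ∧ #(M.contractNonloops J) = #Jᶜ := by
    intro a ha
    have h1 : #Jᶜ * #(M.contractClass J a) = #(M.contractNonloops J) := by
      exact_mod_cast hclass a ha
    have h2 : 0 < #(M.contractClass J a) := card_pos.2 ⟨a, mem_contractClass.2 ⟨ha, rfl⟩⟩
    have h3 := card_le_card hsub
    have h4 : 0 < #Jᶜ := lt_of_lt_of_le (card_pos.2 ⟨a, ha⟩) h3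
    have h5 : #(M.contractClass J a) = 1 := by nlinarith
    exact ⟨h5, by rw [← h1, h5, mul_one]⟩
  -- Without nonloops the homogenizing row would give z₀ = 0, whereas z₀ = -B/A is negative.
  obtain ⟨e, he⟩ : ∃ e, e ∈ M.contractNonloops J := by
    rw [← nonempty_def, nonempty_iff_ne_empty]
    intro h
    rw [h, card_empty, Nat.cast_zero, add_zero] at hx
    have : z none < 0 := div_neg_of_neg_of_pos (neg_lt_zero.2 hBpos) hApos
    exact this.ne ((mul_eq_zero.1 hx).resolve_left (by linarith))
  have hL := eq_of_subset_of_card_le hsub (hclass' e he).2.ge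
  have haL : a ∈ M.contractNonloops J := by rw [hL]; simpa using ha
  have hbL : b ∈ M.contractNonloops J := by rw [hL]; simpa using hb
  refine ((Indep.insert_insert_indep_iff_closure_ne (by simpa using ha)
    (mem_contractNonloops.1 haL).2 (mem_contractNonloops.1 hbL).2).2 fun hcl => ?_).2
  exact hab (card_le_one.1 (hclass' a haL).1.le a (mem_contractClass.2 ⟨haL, rfl⟩) b
    (mem_contractClass.2 ⟨hbL, hcl⟩))

/-- A circuit C with at most d + 2 elements would lie in an independent set: all but at most two of
its elements form an independent set, which extends to an independent J of size d, and C ∪ J fits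
into J with two elements added. -/
theorem lt_girth_of_indep_insert_insert (hr : (d : ℕ∞) ≤ M.eRank)
    (hd : d + 2 ≤ Fintype.card α)
    (h : ∀ J : Finset α, M.Indep (J : Set α) → #J = d → ∀ a b, a ∉ J → b ∉ J → a ≠ b →
      M.Indep (insert a (insert b (J : Set α)))) : ((d + 2 : ℕ) : ℕ∞) < M.girth := by
  rw [lt_girth_iff]
  intro C hC
  by_contra! hcard
  obtain ⟨c, hc⟩ := hC.nonempty
  rw [mem_coe] at hc
  -- For a loop the truncated subtraction gives T = ∅, which still leaves at most two elements of C
  -- outside T.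
  obtain ⟨T, hTC, hT⟩ := exists_subset_card_eq (s := C.erase c) (n := #C - 2)
    (by rw [card_erase_of_mem hc]; omega)
  have hTi : M.Indep (T : Set α) :=
    (hC.sdiff_singleton_indep hc).subset (by rw [← coe_erase]; exact_mod_cast hTC)
  obtain ⟨J, hJ, hJd, hTJ⟩ := hTi.exists_finset_superset (s := d) (by omega) hr
  have hCJ : #(C ∪ J) ≤ d + 2 := by
    have h1 : C ∪ J ⊆ (C \ T) ∪ J := by
      intro x hx
      have := @hTJ x
      simp only [mem_union, mem_sdiff] at hx ⊢
      tauto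
    have h2 := (card_le_card h1).trans (card_union_le _ _)
    rw [card_sdiff_of_subset (hTC.trans (erase_subset _ _)), hT, hJd] at h2
    omega
  obtain ⟨W, hW, -, hWd⟩ := exists_subsuperset_card_eq (subset_univ (C ∪ J)) hCJ
    (by rwa [card_univ])
  have hJW : J ⊆ W := subset_union_right.trans hW
  obtain ⟨a, b, hab, hWJ⟩ := card_eq_two.1
    (show #(W \ J) = 2 by rw [card_sdiff_of_subset hJW, hWd, hJd]; omega)
  have ha : a ∈ W \ J := by simp [hWJ]
  have hb : b ∈ W \ J := by simp [hWJ]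
  refine hC.not_indep ((h J hJ hJd a b (mem_sdiff.1 ha).2 (mem_sdiff.1 hb).2 hab).subset ?_)
  have : C ⊆ insert a (insert b J) := by
    intro x hx
    by_cases hxJ : x ∈ J
    · simp [hxJ]
    · have : x ∈ W \ J := mem_sdiff.2 ⟨hW (mem_union_left _ hx), hxJ⟩
      rw [hWJ] at this
      simp only [mem_insert, mem_singleton] at this ⊢
      tauto
  exact_mod_cast this

theorem normIndep_eq_one {n : ℕ} {M : Matroid (Fin n)} (hE : M.E = Set.univ) {k : ℕ}
    (hk : k ≤ n) (hg : (k : ℕ∞) < M.girth) : M.normIndep k = 1 := by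
  have hc : M.indepsContaining k ∅ = powersetCard k univ := by
    ext I
    rw [mem_indepsContaining, mem_powersetCard]
    refine ⟨fun h => ⟨subset_univ _, h.2.1⟩, fun h => ⟨?_, h.2, empty_subset _⟩⟩
    exact indep_of_card_lt_girth hE (by rwa [h.2])
  rw [normIndep, numIndep_eq_indepCount, indepCount, hc, card_powersetCard, card_univ,
    Fintype.card_fin, div_self]
  exact_mod_cast (Nat.choose_pos hk).ne'

theorem normIndep_mul_eq_sq_iff {n r : ℕ} {M : Matroid (Fin n)} (hE : M.E = Set.univ)
    (hr : M.eRank = r) {k : ℕ} (hk : 1 ≤ k) (hkr : k ≤ r) (hkn : k < n) :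
    M.normIndep (k - 1) * M.normIndep (k + 1) = M.normIndep k ^ 2 ↔
      ((k + 1 : ℕ) : ℕ∞) < M.girth := by
  obtain ⟨d, rfl⟩ : ∃ d, k = d + 1 := ⟨k - 1, by omega⟩
  rw [Nat.add_sub_cancel]
  constructor
  · intro h
    simp only [normIndep, numIndep_eq_indepCount] at h
    have hempty : M.Indep ((∅ : Finset (Fin n)) : Set (Fin n)) := by simp
    have hI1 := indepCount_pos hempty (Nat.zero_le (d + 1)) (by rw [hr]; exact_mod_cast hkr)
    have c0 : (0 : ℝ) < n.choose d := by exact_mod_cast Nat.choose_pos (by omega)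
    have c1 : (0 : ℝ) < n.choose (d + 1) := by exact_mod_cast Nat.choose_pos (by omega)
    have c2 : (0 : ℝ) < n.choose (d + 2) := by exact_mod_cast Nat.choose_pos (by omega)
    -- At k = r the left side is zero while the right side is positive, so equality forces k < r.
    have hlt : d + 2 ≤ r := by
      by_contra! hlt
      have : M.indepCount (d + 1 + 1) ∅ = 0 := by
        rw [indepCount, Nat.cast_eq_zero, card_eq_zero, eq_empty_iff_forall_notMem]
        intro I hI
        obtain ⟨hI, hc, -⟩ := mem_indepsContaining.1 hI
        have h' := hI.encard_le_eRank
        rw [Set.encard_coe_eq_coe_finsetCard, hr, hc] at h'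
        have : d + 2 ≤ r := by exact_mod_cast h'
        omega
      rw [this, zero_div, mul_zero] at h
      have : 0 < (M.indepCount (d + 1) ∅ / (n.choose (d + 1) : ℝ)) ^ 2 := by positivity
      exact this.ne h
    have hr' : ((d + 2 : ℕ) : ℕ∞) ≤ M.eRank := by rw [hr]; exact_mod_cast hlt
    have e1 : (n.choose (d + 1) : ℝ) * (d + 1) = n.choose d * (n - d) := by
      have := Nat.choose_succ_right_eq n d
      rw [← Nat.cast_sub (by omega)]
      exact_mod_cast this
    have e2 : (n.choose (d + 2) : ℝ) * (d + 2) = n.choose (d + 1) * (n - d - 1) := by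
      have := Nat.choose_succ_right_eq n (d + 1)
      rw [sub_sub, ← Nat.cast_add_one, ← Nat.cast_sub (by omega)]
      exact_mod_cast this
    refine lt_girth_of_indep_insert_insert (le_trans (by exact_mod_cast Nat.le_add_right d 2) hr')
      (by rw [Fintype.card_fin]; omega) fun J hJ hJd a b ha hb hab =>
      indep_insert_insert_of_indepCount_eq hr' ?_ hJ hJd ha hb hab
    rw [Fintype.card_fin]
    rw [div_mul_div_comm, div_pow, div_eq_div_iff (by positivity) (by positivity)] at h
    change M.indepCount d ∅ * M.indepCount (d + 2) ∅ * _ = _ * (_ * (n.choose (d + 2) : ℝ)) at h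
    have hp : (0 : ℝ) < n.choose d * n.choose (d + 1) ^ 2 := by positivity
    refine mul_left_cancel₀ hp.ne' ?_
    linear_combination (n.choose d * (n - d) * (d + 2) : ℝ) * h
      + (n.choose d * n.choose (d + 1) * (d + 1) * M.indepCount (d + 1) ∅ ^ 2 : ℝ) * e2
      - (n.choose d * n.choose (d + 2) * (d + 2) * M.indepCount (d + 1) ∅ ^ 2 : ℝ) * e1
  · intro h
    have hle : ∀ {s : ℕ}, s ≤ d + 2 → (s : ℕ∞) < M.girth := fun hs =>
      lt_of_le_of_lt (by exact_mod_cast hs) h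
    rw [normIndep_eq_one hE (by omega) (hle (by omega)),
      normIndep_eq_one hE (by omega) (hle (by omega)),
      normIndep_eq_one hE (by omega) (hle (by omega))]
    norm_num

end Matroid

/-! ### Correlation equality for bases and parallel classes. -/

namespace Matroid

theorem isCircuit_pair_iff {α : Type*} {M : Matroid α} {e f : α} (he : M.IsNonloop e)
    (hf : M.IsNonloop f) (hef : e ≠ f) : M.IsCircuit {e, f} ↔ ¬ M.Indep {e, f} := by
  refine ⟨fun h => h.not_indep, fun h => ?_⟩
  rw [isCircuit_iff_dep_forall_sdiff_singleton_indep]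
  refine ⟨⟨h, Set.pair_subset he.mem_ground hf.mem_ground⟩, ?_⟩
  rintro x (rfl | rfl)
  · exact hf.indep.subset (by simp)
  · exact he.indep.subset (by rw [Set.pair_comm]; simp)

/-- In terms of closures, symmetry and transitivity of parallelism are immediate. -/
theorem areParallel_iff {α : Type*} {M : Matroid α} {e f : α} :
    M.AreParallel e f ↔ M.IsNonloop e ∧ M.IsNonloop f ∧ M.closure {f} = M.closure {e} := by
  by_cases hef : e = f
  · subst hef
    simp [AreParallel]
  have key : M.IsNonloop e → M.IsNonloop f →
      (M.Indep {e, f} ↔ M.closure {f} ≠ M.closure {e}) := fun he hf => by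
    have := Indep.insert_insert_indep_iff_closure_ne (M := M) (J := ∅) (a := e) (b := f)
      (Set.notMem_empty _) (by simpa using he) (by simpa using hf)
    simpa [hef] using this
  simp only [AreParallel, hef, false_and, ne_eq, not_false_eq_true, true_and, false_or]
  constructor
  · intro h
    have he : M.IsNonloop e := by
      rw [← indep_singleton]
      exact h.ssubset_indep ⟨by simp, fun hs => hef (hs (by simp) : f = e).symm⟩
    have hf : M.IsNonloop f := by
      rw [← indep_singleton]
      exact h.ssubset_indep ⟨by simp, fun hs => hef (hs (by simp) : e = f)⟩
    exact ⟨he, hf, by_contra fun hne => h.not_indep ((key he hf).2 hne)⟩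
  · rintro ⟨he, hf, hcl⟩
    exact (isCircuit_pair_iff he hf hef).2 fun hi => (key he hf).1 hi hcl

theorem indep_pair_iff_not_areParallel {α : Type*} {M : Matroid α} {e f : α}
    (he : M.IsNonloop e) (hf : M.IsNonloop f) (hef : e ≠ f) :
    M.Indep {e, f} ↔ ¬ M.AreParallel e f := by
  rw [AreParallel, isCircuit_pair_iff he hf hef]
  tauto

theorem parallelClasses_encard_eq_two_iff {α : Type*} {M : Matroid α} {i j : α}
    (hi : M.IsNonloop i) (hj : M.IsNonloop j) (hij : ¬ M.AreParallel i j) :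
    M.parallelClasses.encard = 2 ↔
      ∀ l, M.IsNonloop l → M.AreParallel l i ∨ M.AreParallel l j := by
  have hself : ∀ e, M.IsNonloop e → M.AreParallel e e := fun e he => Or.inl ⟨rfl, he⟩
  have hne : {f | M.AreParallel i f} ≠ {f | M.AreParallel j f} := fun h =>
    hij (h.symm ▸ hself j hj : j ∈ {f | M.AreParallel i f})
  have hmi : {f | M.AreParallel i f} ∈ M.parallelClasses := ⟨i, hi, rfl⟩
  have hmj : {f | M.AreParallel j f} ∈ M.parallelClasses := ⟨j, hj, rfl⟩
  have hcls : ∀ l e, M.AreParallel l e → {f | M.AreParallel l f} = {f | M.AreParallel e f} := by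
    intro l e hle
    rw [areParallel_iff] at hle
    ext f
    simp only [Set.mem_ofPred_eq, areParallel_iff, hle.1, hle.2.1, hle.2.2]
  constructor
  · intro h l hl
    have hsub : {{f | M.AreParallel i f}, {f | M.AreParallel j f}} ⊆ M.parallelClasses :=
      Set.pair_subset hmi hmj
    have heq := (Set.toFinite _).eq_of_subset_of_encard_le hsub (by rw [h, Set.encard_pair hne])
    have hl' : {f | M.AreParallel l f} ∈ M.parallelClasses := ⟨l, hl, rfl⟩
    rw [← heq] at hl'
    rcases hl' with h' | h'
    · left
      exact (h'.symm ▸ hself i hi : i ∈ {f | M.AreParallel l f})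
    · right
      exact (h'.symm ▸ hself j hj : j ∈ {f | M.AreParallel l f})
  · intro h
    rw [show M.parallelClasses = {{f | M.AreParallel i f}, {f | M.AreParallel j f}} from ?_,
      Set.encard_pair hne]
    refine Set.Subset.antisymm ?_ (Set.pair_subset hmi hmj)
    rintro _ ⟨l, hl, rfl⟩
    rcases h l hl with h' | h'
    · exact Or.inl (hcls l i h')
    · exact Or.inr (hcls l j h')

variable {α : Type*} [Fintype α] {M : Matroid α}

theorem mem_contractNonloops_empty {a : α} : a ∈ M.contractNonloops ∅ ↔ M.IsNonloop a := by
  simp [mem_contractNonloops]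

theorem mem_contractClass_empty {a b : α} (ha : M.IsNonloop a) :
    b ∈ M.contractClass ∅ a ↔ M.AreParallel a b := by
  rw [mem_contractClass, mem_contractNonloops_empty, areParallel_iff]
  simp [ha]

variable [DecidableEq α] {d : ℕ}

/-- Equality in the correlation inequality forces every nonloop to be parallel to `i` or `j`. -/
theorem areParallel_or_areParallel_of_indepCount_eq (hr : M.eRank = ((d + 2 : ℕ) : ℕ∞)) {i j : α}
    (hij : i ≠ j) (hi : M.IsNonloop i) (hj : M.IsNonloop j)
    (heq : (d + 2) * (M.indepCount (d + 2) ∅ * M.indepCount (d + 2) {i, j})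
      = 2 * (d + 1) * M.indepCount (d + 2) {i} * M.indepCount (d + 2) {j})
    {l : α} (hl : M.IsNonloop l) : M.AreParallel l i ∨ M.AreParallel l j := by
  by_contra! hlij
  obtain ⟨hli, hlj⟩ := hlij
  have hli' : l ≠ i := by rintro rfl; exact hli (Or.inl ⟨rfl, hl⟩)
  have hlj' : l ≠ j := by rintro rfl; exact hlj (Or.inl ⟨rfl, hl⟩)
  have hiI : M.Indep (({i} : Finset α) : Set α) := by simpa using hi
  have hjI : M.Indep (({j} : Finset α) : Set α) := by simpa using hj
  have hempty : M.Indep ((∅ : Finset α) : Set α) := by simp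
  set F := M.indepCount (d + 2) ∅ with hF
  set Fi := M.indepCount (d + 2) {i} with hFi
  set Fj := M.indepCount (d + 2) {j} with hFj
  set Fij := M.indepCount (d + 2) {i, j} with hFij
  have hFpos : 0 < F := indepCount_pos hempty (Nat.zero_le _) hr.ge
  have hFipos : 0 < Fi := indepCount_pos hiI (by simp) hr.ge
  have hFjpos : 0 < Fj := indepCount_pos hjI (by simp) hr.ge
  set H := M.indepHessian d ∅ with hH
  have hsymm : ∀ a b, H a b = H b a := fun a b => indepHessian_isSymm.apply b a
  have hHij : H (some i) (some j) = Fij := by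
    rw [hH, indepHessian_some_some, if_neg (by simp [hij]), insert_empty_eq]
  have hHself : ∀ a, H (some a) (some a) = 0 := fun a => by
    rw [hH, indepHessian_some_some, if_pos (by simp)]
  set c : ℝ := -(2 * Fi * Fj / ((d + 2) * F)) with hc
  have hcneg : c < 0 := neg_lt_zero.2 (by positivity)
  have hcF : c * ((d + 2) * F) = -(2 * Fi * Fj) := by
    rw [hc]; field_simp
  -- The equality makes the form degenerate on the span of the evaluation point and the basis
  -- vectors at i and j. This z is orthogonal to all three, hence isotropic. Off i and j its
  -- original coordinates equal c < 0.
  set z : Option α → ℝ :=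
    c • nonHomogenizing α + Pi.single (some i) Fj + Pi.single (some j) Fi with hz
  have hrow : ∀ o, (H *ᵥ z) o = c * (H *ᵥ nonHomogenizing α) o + H o (some i) * Fj
      + H o (some j) * Fi := by
    intro o
    simp only [hz, mulVec_add, mulVec_smul, Pi.add_apply, Pi.smul_apply, smul_eq_mul,
      mulVec_single, col_apply, MulOpposite.smul_eq_mul_unop, MulOpposite.unop_op]
  have hw : ∀ a, (H *ᵥ nonHomogenizing α) (some a) = (d + 1) * M.indepCount (d + 2) {a} := by
    intro a
    rw [← sum_indepHessian_empty_some, mulVec, dotProduct, Fintype.sum_option]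
    simp [nonHomogenizing, hH]
  have hww : nonHomogenizing α ⬝ᵥ H *ᵥ nonHomogenizing α = (d + 1) * ((d + 2) * F) := by
    have h2 := M.sum_indepCount_singleton (d + 2)
    push_cast at h2
    rw [dotProduct, Fintype.sum_option]
    simp only [nonHomogenizing, zero_mul, one_mul, zero_add, hw, ← mul_sum, h2, hF]
  have hzi : (H *ᵥ z) (some i) = 0 := by
    rw [hrow, hw, hHself, hHij, ← hFi]
    refine mul_left_cancel₀ (show ((d : ℝ) + 2) * F ≠ 0 by positivity) ?_
    linear_combination ((d : ℝ) + 1) * Fi * hcF + Fi * heq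
  have hzj : (H *ᵥ z) (some j) = 0 := by
    rw [hrow, hw, hHself, hsymm, hHij, ← hFj]
    refine mul_left_cancel₀ (show ((d : ℝ) + 2) * F ≠ 0 by positivity) ?_
    linear_combination ((d : ℝ) + 1) * Fj * hcF + Fj * heq
  have hzw : z ⬝ᵥ H *ᵥ nonHomogenizing α = 0 := by
    simp only [hz, add_dotProduct, smul_dotProduct, hww, single_dotProduct, hw, smul_eq_mul,
      ← hFi, ← hFj]
    linear_combination ((d : ℝ) + 1) * hcF
  have hzz : z ⬝ᵥ H *ᵥ z = 0 := by
    have : z ⬝ᵥ H *ᵥ z = c * (nonHomogenizing α ⬝ᵥ H *ᵥ z) + Fj * (H *ᵥ z) (some i)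
        + Fi * (H *ᵥ z) (some j) := by
      conv_lhs => rw [hz, add_dotProduct, add_dotProduct, smul_dotProduct, ← hz]
      simp only [single_dotProduct, smul_eq_mul]
    rw [this, hzi, hzj, dotProduct_indepHessian_mulVec_comm, hzw]
    ring
  have hker := (hasLorentzianHessian hr.ge hempty (Nat.zero_le d)).mulVec_eq_zero
    (w := nonHomogenizing α) (z := z) (by rw [← hH, hww]; positivity) hzz hzw
  have hilI : M.Indep (({i, l} : Finset α) : Set α) := by
    rw [coe_pair, Set.pair_comm]
    exact (indep_pair_iff_not_areParallel hl hi hli').2 hli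
  have hjlI : M.Indep {j, l} := by
    rw [Set.pair_comm]
    exact (indep_pair_iff_not_areParallel hl hj hlj').2 hlj
  -- With J = B \ {i, l}, neither i nor j may be parallel to l in M ／ J. For i this is the
  -- independence of B. For j, either j lies in J, or i is in the closure of {j, l}, so that j
  -- parallel to l over J would put i in the closure of J ∪ {l}.
  obtain ⟨B, hB, hBd, hilB, hjB⟩ : ∃ B : Finset α, M.Indep (B : Set α) ∧ #B = d + 2 ∧
      {i, l} ⊆ B ∧ (j ∈ B ∨ ¬ M.Indep (insert i ({j, l} : Set α))) := by
    by_cases h : M.Indep (insert i ({j, l} : Set α))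
    · have hd : 2 + 1 ≤ d + 2 := by
        have := h.encard_le_eRank
        rw [hr, Set.encard_insert_of_notMem (by simp [hij, hli'.symm]), Set.encard_pair hlj'.symm]
          at this
        exact_mod_cast this
      obtain ⟨B, h1, h2, h3⟩ := Indep.exists_finset_superset (X := {i, j, l}) (M := M)
        (s := d + 2) (by simpa using h) (card_le_three.trans hd) hr.ge
      exact ⟨B, h1, h2, fun x hx => h3 (by grind), Or.inl (h3 (by simp))⟩
    · obtain ⟨B, h1, h2, h3⟩ := hilI.exists_finset_superset (s := d + 2)
        (card_le_two.trans (by omega)) hr.ge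
      exact ⟨B, h1, h2, h3, Or.inr h⟩
  have hiB : i ∈ B := hilB (by simp)
  have hlB : l ∈ B := hilB (by simp)
  set J := (B.erase i).erase l with hJ
  have hJl : insert l J = B.erase i := insert_erase (mem_erase.2 ⟨hli', hlB⟩)
  have hJl' : insert l (J : Set α) = (B.erase i : Finset α) := by rw [← coe_insert, hJl]
  have hJil : insert i (insert l (J : Set α)) = B := by
    rw [hJl', ← coe_insert, insert_erase hiB]
  have hJB : (J : Set α) ⊆ B := by
    rw [← hJil]; exact (Set.subset_insert _ _).trans (Set.subset_insert _ _)
  have hJI : M.Indep (J : Set α) := hB.subset hJB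
  have hJd : #J = d := by
    rw [card_erase_of_mem (mem_erase.2 ⟨hli', hlB⟩), card_erase_of_mem hiB, hBd]
    rfl
  have hlJ : l ∉ J := notMem_erase _ _
  have hlI : M.Indep (insert l (J : Set α)) := hB.subset (by rw [← hJil]; exact Set.subset_insert _ _)
  have hlL : l ∈ M.contractNonloops J := mem_contractNonloops.2 ⟨hlJ, hlI⟩
  have hicl : i ∉ M.closure (insert l (J : Set α)) := by
    rw [hlI.notMem_closure_iff_of_notMem (by rw [hJl']; simp) hi.mem_ground, hJil]
    exact hB
  have hicls : i ∉ M.contractClass J l := by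
    intro h
    obtain ⟨h1, h2⟩ := mem_contractClass.1 h
    rw [← h2] at hicl
    exact hicl (M.mem_closure_of_mem (Set.mem_insert _ _)
      (mem_contractNonloops.1 h1).2.subset_ground)
  have hjcls : j ∉ M.contractClass J l := by
    intro h
    obtain ⟨h1, h2⟩ := mem_contractClass.1 h
    obtain ⟨hjJ, hjI'⟩ := mem_contractNonloops.1 h1
    rcases hjB with hjB | hjB
    · exact hjJ (mem_erase.2 ⟨hlj'.symm, mem_erase.2 ⟨hij.symm, hjB⟩⟩)
    · have hjl : {j, l} ⊆ M.closure (insert l (J : Set α)) := by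
        refine Set.pair_subset ?_
          (M.mem_closure_of_mem (Set.mem_insert _ _) hlI.subset_ground)
        rw [← h2]
        exact M.mem_closure_of_mem (Set.mem_insert _ _) hjI'.subset_ground
      refine hicl (closure_subset_closure_of_subset_closure hjl ?_)
      by_contra hcon
      exact hjB ((hjlI.notMem_closure_iff_of_notMem (by simp [hij, hli'.symm])
        hi.mem_ground).1 hcon)
  have hkerJ := indepHessian_mulVec_eq_zero_of_empty hr.ge hker hJI hJd.le
  have hz0 : z none = 0 := by simp [hz, nonHomogenizing]
  have hn : (d : ℝ) + 2 ≤ Fintype.card α := by exact_mod_cast card_le_of_coe_le_eRank hr.ge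
  have hrow0 := indepHessian_mulVec_none_of_card_eq hJI hJd z
  have hrowl := indepHessian_mulVec_some_of_card_eq hJd hlL z
  rw [hkerJ, Pi.zero_apply, hz0, mul_zero, zero_add] at hrow0 hrowl
  -- As z₀ = 0, the homogenizing row makes the sum of z over all nonloops of M ／ J vanish; row l
  -- then makes its sum over the class of l vanish, although every term there is c < 0.
  have hT := (mul_eq_zero.1 hrow0.symm).resolve_left (by linarith)
  have hsum : ∑ b ∈ M.contractClass J l, z (some b) = #(M.contractClass J l) * c := by
    rw [← nsmul_eq_mul]
    refine sum_eq_card_nsmul fun b hb => ?_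
    have h1 : b ≠ i := by rintro rfl; exact hicls hb
    have h2 : b ≠ j := by rintro rfl; exact hjcls hb
    simp [hz, nonHomogenizing, h1, h2]
  have hcard : (0 : ℝ) < #(M.contractClass J l) :=
    Nat.cast_pos.2 (card_pos.2 ⟨l, mem_contractClass.2 ⟨hlL, rfl⟩⟩)
  rw [hT, hsum] at hrowl
  linarith [mul_neg_of_pos_of_neg hcard hcneg]

/-- A matroid with exactly two parallel classes has rank two, and attains equality in the
correlation inequality. -/
theorem indepCount_eq_of_areParallel_or_areParallel
    (hr : M.eRank = ((d + 2 : ℕ) : ℕ∞)) {i j : α} (hij : i ≠ j) (hi : M.IsNonloop i)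
    (hj : M.IsNonloop j) (hpar : ¬ M.AreParallel i j)
    (h : ∀ l, M.IsNonloop l → M.AreParallel l i ∨ M.AreParallel l j) :
    (d + 2) * (M.indepCount (d + 2) ∅ * M.indepCount (d + 2) {i, j})
      = 2 * (d + 1) * M.indepCount (d + 2) {i} * M.indepCount (d + 2) {j} := by
  have hijI : M.Indep {i, j} := (indep_pair_iff_not_areParallel hi hj hij).2 hpar
  have hbase : M.IsBase {i, j} := by
    refine hijI.isBase_of_ground_subset_closure fun l hl => ?_
    by_cases hl' : M.IsNonloop l
    · have hmem : l ∈ M.closure {l} := M.mem_closure_self l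
      rcases h l hl' with h' | h'
      · rw [← (areParallel_iff.1 h').2.2] at hmem
        exact M.closure_subset_closure (by simp) hmem
      · rw [← (areParallel_iff.1 h').2.2] at hmem
        exact M.closure_subset_closure (by simp) hmem
    · exact ((not_isNonloop_iff hl).1 hl').mem_closure _
  -- Every nonloop is parallel to i or j, so {i, j} is a base and the rank is 2. With classes P of i
  -- and Q of j, the counts are |P||Q| bases in all, |Q| through i, |P| through j, and one through
  -- both.
  have hd : d = 0 := by
    have := hbase.encard_eq_eRank
    rw [hr, Set.encard_pair hij] at this
    have : 2 = d + 2 := by exact_mod_cast this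
    omega
  subst hd
  have hsymm : ∀ {a b : α}, M.AreParallel a b → M.AreParallel b a := fun h => by
    rw [areParallel_iff] at h ⊢
    exact ⟨h.2.1, h.1, h.2.2.symm⟩
  have htrans : ∀ {a b c : α}, M.AreParallel a b → M.AreParallel b c → M.AreParallel a c :=
    fun h h' => by
      rw [areParallel_iff] at h h' ⊢
      exact ⟨h.1, h'.2.1, h'.2.2.trans h.2.2⟩
  set P := M.contractClass ∅ i
  set Q := M.contractClass ∅ j
  have hP : ∀ {a}, a ∈ P ↔ M.AreParallel i a := mem_contractClass_empty hi
  have hQ : ∀ {a}, a ∈ Q ↔ M.AreParallel j a := mem_contractClass_empty hj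
  have hdisj : Disjoint P Q := disjoint_left.2 fun a ha hb =>
    hpar (htrans (hP.1 ha) (hsymm (hQ.1 hb)))
  have hL : M.contractNonloops ∅ = P ∪ Q := by
    ext a
    rw [mem_contractNonloops_empty, mem_union, hP, hQ]
    exact ⟨fun ha => (h a ha).imp hsymm hsymm,
      fun ha => ha.elim (fun h => (areParallel_iff.1 h).2.1) fun h => (areParallel_iff.1 h).2.1⟩
  have hclass : ∀ {a e}, M.AreParallel e a → M.contractClass ∅ a = M.contractClass ∅ e := by
    intro a e hea
    have hea' := areParallel_iff.1 hea
    ext b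
    rw [mem_contractClass_empty hea'.1, mem_contractClass_empty hea'.2.1]
    exact ⟨htrans hea, htrans (hsymm hea)⟩
  have hcount : ∀ a ∈ M.contractNonloops ∅,
      M.indepCount 2 {a} = #P + #Q - #(M.contractClass ∅ a) := by
    intro a ha
    have h1 := M.sum_indepHessian_empty_some 0 a
    have h2 := indepHessian_mulVec_some_of_card_eq (d := 0) (J := ∅) card_empty ha
      (nonHomogenizing α)
    rw [mulVec, dotProduct, Fintype.sum_option] at h2
    simp only [nonHomogenizing, mul_zero, mul_one, zero_add, sum_const, nsmul_eq_mul, h1, hL,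
      card_union_of_disjoint hdisj] at h2
    push_cast at h2
    linarith
  have hcP : ∀ a ∈ P, M.indepCount 2 {a} = #Q := fun a ha => by
    rw [hcount a (by rw [hL]; exact mem_union_left _ ha), hclass (hP.1 ha)]; ring
  have hcQ : ∀ a ∈ Q, M.indepCount 2 {a} = #P := fun a ha => by
    rw [hcount a (by rw [hL]; exact mem_union_right _ ha), hclass (hQ.1 ha)]; ring
  have htotal : 2 * M.indepCount 2 ∅ = 2 * (#P * #Q) := by
    have h1 := M.sum_indepCount_singleton 2
    rw [← sum_subset (subset_univ (P ∪ Q)), sum_union hdisj, sum_congr rfl hcP,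
      sum_congr rfl hcQ] at h1
    · simp only [sum_const, nsmul_eq_mul] at h1
      push_cast at h1
      linarith
    · intro a _ ha
      rw [← hL, mem_contractNonloops_empty] at ha
      exact indepCount_of_not_indep (by simpa using ha)
  have hpair : M.indepCount 2 {i, j} = 1 := by
    rw [← card_pair hij]
    exact indepCount_card_eq_one (by simpa using hijI)
  simp only [zero_add, hpair, hcP i (hP.2 (Or.inl ⟨rfl, hi⟩)), hcQ j (hQ.2 (Or.inl ⟨rfl, hj⟩))]
  push_cast
  linarith

theorem ncard_isBase_mul_numBasesContaining_pair_eq_iff {r : ℕ}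
    (hr : M.eRank = r) (hr2 : 2 ≤ r) {i j : α} (hij : i ≠ j) (hi : M.IsNonloop i)
    (hj : M.IsNonloop j) :
    (({B : Set α | M.IsBase B}.ncard : ℝ) * (M.numBasesContaining {i, j} : ℝ)
        = 2 * (1 - 1 / (r : ℝ)) * (M.numBasesContaining {i} : ℝ)
          * (M.numBasesContaining {j} : ℝ)) ↔
      ¬ M.AreParallel i j ∧ M.parallelClasses.encard = 2 := by
  obtain ⟨d, rfl⟩ : ∃ d, r = d + 2 := ⟨r - 2, by omega⟩
  have h0 : {B : Set α | M.IsBase B}.ncard = M.numBasesContaining ((∅ : Finset α) : Set α) := by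
    simp [numBasesContaining]
  rw [h0, ← coe_pair, ← coe_singleton, ← coe_singleton]
  simp only [numBasesContaining_eq_indepCount hr]
  have hd : (d : ℝ) + 2 ≠ 0 := by positivity
  have hiff : (M.indepCount (d + 2) ∅ * M.indepCount (d + 2) {i, j}
      = 2 * (1 - 1 / ((d + 2 : ℕ) : ℝ)) * M.indepCount (d + 2) {i} * M.indepCount (d + 2) {j}) ↔
      (d + 2) * (M.indepCount (d + 2) ∅ * M.indepCount (d + 2) {i, j})
      = 2 * (d + 1) * M.indepCount (d + 2) {i} * M.indepCount (d + 2) {j} := by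
    rw [← mul_right_inj' hd]
    push_cast
    have : ((d : ℝ) + 2) * (2 * (1 - 1 / (d + 2)) * M.indepCount (d + 2) {i}
        * M.indepCount (d + 2) {j})
        = 2 * (d + 1) * M.indepCount (d + 2) {i} * M.indepCount (d + 2) {j} := by
      field_simp
      ring
    rw [this]
  rw [hiff]
  constructor
  · intro heq
    -- If i and j were parallel, no base would contain both and the left side would vanish, while
    -- the right side is positive.
    have hpar : ¬ M.AreParallel i j := by
      rw [← indep_pair_iff_not_areParallel hi hj hij, ← coe_pair]
      have h1 := indepCount_pos (M := M) (X := {i}) (s := d + 2) (by simpa using hi) (by simp) hr.ge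
      have h2 := indepCount_pos (M := M) (X := {j}) (s := d + 2) (by simpa using hj) (by simp) hr.ge
      by_contra hI
      rw [indepCount_of_not_indep hI, mul_zero, mul_zero] at heq
      have : 0 < 2 * ((d : ℝ) + 1) * M.indepCount (d + 2) {i} * M.indepCount (d + 2) {j} := by
        positivity
      exact this.ne heq
    exact ⟨hpar, (parallelClasses_encard_eq_two_iff hi hj hpar).2 fun l hl =>
      areParallel_or_areParallel_of_indepCount_eq hr hij hi hj heq hl⟩
  · rintro ⟨hpar, hcls⟩
    exact indepCount_eq_of_areParallel_or_areParallel hr hij hi hj hpar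
      ((parallelClasses_encard_eq_two_iff hi hj hpar).1 hcls)

end Matroid

theorem corollary1p2 (n r : ℕ) (M : Matroid (Fin n)) (hE : M.E = Set.univ)
    (hr : M.eRank = (r : ℕ∞)) (hr2 : 2 ≤ r) :
    (∀ i j : Fin n, i ≠ j → ¬ M.IsLoop i → ¬ M.IsLoop j →
      (({B : Set (Fin n) | M.IsBase B}.ncard : ℝ) * (M.numBasesContaining {i, j} : ℝ)
          = 2 * (1 - 1 / (r : ℝ)) * (M.numBasesContaining {i} : ℝ)
              * (M.numBasesContaining {j} : ℝ)
        ↔ ¬ M.AreParallel i j ∧ M.parallelClasses.encard = 2)) ∧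
    (∀ k : ℕ, 1 ≤ k → k ≤ r → k < n →
      (M.normIndep (k - 1) * M.normIndep (k + 1) = (M.normIndep k) ^ 2
        ↔ ((k + 1 : ℕ) : ℕ∞) < M.girth)) := by
  have hmem : ∀ e, e ∈ M.E := fun e => by rw [hE]; exact Set.mem_univ e
  refine ⟨fun i j hij hi hj => ?_, fun k hk hkr hkn => ?_⟩
  · exact Matroid.ncard_isBase_mul_numBasesContaining_pair_eq_iff hr hr2 hij
      ((Matroid.not_isLoop_iff (hmem i)).1 hi) ((Matroid.not_isLoop_iff (hmem j)).1 hj)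
  · exact Matroid.normIndep_mul_eq_sq_iff hE hr hk hkr hkn
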